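/- Let $N\ge 2$ and let $\Omega\subset\mathbb R^N$ be an open ball $\{|x|<R\}$, $R>0$, or an open annulus $\{a<|x|<b\}$, $0<a<b$, centered at the origin $O$. Let $f:\Omega\times\mathbb R\to\mathbb R$ be a Carathéodory function such that $f(\cdot,t)$ is radial for every $t\in\mathbb R$. Assume that $f$ is subcritical: $$|f(x,t)|\le C\,(|t|^{r-1}+1)\qquad\text{for a.a. }x\in\Omega\text{ and all }t\in\mathbb R,$$ where $C>0$, $r>1$, and $r<2N/(N-2)$ if $N\ge 3$; and that $f$ is Lipschitz on bounded sets: for each $M>0$ there is a constant $C_M>0$ such that $$|f(x,s)-f(x,t)|\le C_M|s-t|\qquad\text{for a.a. }x\in\Omega\text{ and all }s,t\in[-M,M].$$ Let $u_0\in C^2(\Omega)\cap C(\overline\Omega)$ be a classical solution of $-\Delta u=f(x,u)$ in $\Omega$, $u=0$ on $\partial\Omega$ (such a $u_0$ belongs to $H^1_0(\Omega)$), let $P\in\Omega$ be a critical point of $u_0$, and let $$\Phi(u)=\int_\Omega \tfrac12|\nabla u|^2-F(x,u),\quad u\in H^1_0(\Omega),\qquad F(x,t)=\int_0^t f(x,s)\,ds.$$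 Assume that $f(x,\cdot)$ is convex on $\mathbb R$ for a.a. $x\in\Omega$. Suppose that either $P\ne O$ and $u_0$ is not axially symmetric with respect to the line $OP$ (i.e. $u_0(x)$ is not a function of the projection of $x$ to this line and the distance of $x$ from it only), or $P=O$ and $u_0$ is not radially symmetric. Then there is a $2$-dimensional subspace $V\subset H^1_0(\Omega)$, containing sign-definite functions (nonzero functions that do not change sign), such that $u_0$ is a local maximizer of $\Phi|_{u_0+V}$. If moreover $f(x,\cdot)$ is strictly convex on $\mathbb R$ for a.a. $x\in\Omega$, then $u_0$ is a strict local maximizer of $\Phi|_{u_0+V}$. If $u_0\ge 0$ in $\Omega$, the convexity and strict convexity assumptions are needed only on $[0,\infty)$. -/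

import Mathlib

open MeasureTheory Set Filter Topology
open scoped ContDiff

noncomputable section

/-- `ℝ^N` with its Euclidean norm. -/
abbrev RN (N : ℕ) : Type := EuclideanSpace ℝ (Fin N)

/-- `Ω` is an open ball or an open annulus centred at the origin `O`. -/
def IsBallOrAnnulus {N : ℕ} (Ω : Set (RN N)) : Prop :=
  (∃ R : ℝ, 0 < R ∧ Ω = Metric.ball 0 R) ∨
    (∃ a b : ℝ, 0 < a ∧ a < b ∧ Ω = {x | a < ‖x‖ ∧ ‖x‖ < b})

/-- `u` is radially symmetric on `Ω`: its value depends only on `|x|`. -/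
def IsRadialOn {N : ℕ} (Ω : Set (RN N)) (u : RN N → ℝ) : Prop :=
  ∀ x ∈ Ω, ∀ y ∈ Ω, ‖x‖ = ‖y‖ → u x = u y

/-- `u` is axially symmetric on `Ω` with respect to the line `OP` (for `P ≠ O`): its value at `x`
depends only on the orthogonal projection of `x` to the line and on the distance of `x` from the
line, that is, only on `⟪x, P⟫` and `|x|`. -/
def IsAxiallySymmetricOn {N : ℕ} (Ω : Set (RN N)) (P : RN N) (u : RN N → ℝ) : Prop :=
  ∀ x ∈ Ω, ∀ y ∈ Ω, inner ℝ x P = inner ℝ y P → ‖x‖ = ‖y‖ → u x = u y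

/-- `f` is a Carathéodory function on `Ω × ℝ`: measurable in the first variable, and for almost
every value of the first variable continuous in the second one. -/
def IsCaratheodoryOn {N : ℕ} (Ω : Set (RN N)) (f : RN N → ℝ → ℝ) : Prop :=
  (∀ t : ℝ, AEMeasurable (fun x => f x t) (volume.restrict Ω)) ∧
    ∀ᵐ x ∂(volume.restrict Ω), Continuous (f x)

/-- `u ∈ C²(Ω) ∩ C(closure Ω)` is a classical solution of `-Δu = f(x,u)` in `Ω`, `u = 0` on
`∂Ω`. -/
structure IsClassicalSolution {N : ℕ} (Ω : Set (RN N)) (f : RN N → ℝ → ℝ) (u : RN N → ℝ) :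
    Prop where
  contDiffOn : ContDiffOn ℝ 2 u Ω
  continuousOn : ContinuousOn u (closure Ω)
  equation : ∀ x ∈ Ω, -(Laplacian.laplacian u x) = f x (u x)
  boundary : ∀ x ∈ frontier Ω, u x = 0

/-- The Hilbert space `L²(Ω) × L²(Ω; ℝ^N)`, whose norm on pairs `(u, ∇u)` is the `H¹` norm
`(∫_Ω u² + |∇u|²)^(1/2)`. -/
abbrev L2Pair {N : ℕ} (Ω : Set (RN N)) : Type :=
  WithLp 2 (Lp ℝ 2 (volume.restrict Ω) × Lp (RN N) 2 (volume.restrict Ω))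

/-- The subspace of all pairs `(φ, ∇φ)` with a test function `φ ∈ C_c^∞(Ω)`. -/
def testPairs {N : ℕ} (Ω : Set (RN N)) : Submodule ℝ (L2Pair Ω) where
  carrier := {p | ∃ φ : RN N → ℝ, ContDiff ℝ ∞ φ ∧ HasCompactSupport φ ∧ tsupport φ ⊆ Ω ∧
    p.fst =ᵐ[volume.restrict Ω] φ ∧ p.snd =ᵐ[volume.restrict Ω] gradient φ}
  zero_mem' := by
    refine ⟨0, contDiff_const, HasCompactSupport.zero, by simp [tsupport], ?_, ?_⟩
    · exact Lp.coeFn_zero _ _ _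
    · have h : gradient (0 : RN N → ℝ) = 0 := by
        funext x
        exact gradient_const x 0
      rw [h]
      exact Lp.coeFn_zero _ _ _
  add_mem' := by
    rintro p q ⟨φ, h1, h2, h3, h4, h5⟩ ⟨ψ, k1, k2, k3, k4, k5⟩
    refine ⟨φ + ψ, h1.add k1, h2.add k2,
      (tsupport_add φ ψ).trans (union_subset h3 k3), ?_, ?_⟩
    · exact (Lp.coeFn_add _ _).trans (h4.add k4)
    · have h : gradient (φ + ψ) = gradient φ + gradient ψ := by
        funext x
        simp only [gradient, Pi.add_apply]
        rw [fderiv_add (h1.differentiable (by simp) x) (k1.differentiable (by simp) x), map_add]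
      rw [h]
      exact (Lp.coeFn_add _ _).trans (h5.add k5)
  smul_mem' := by
    rintro c p ⟨φ, h1, h2, h3, h4, h5⟩
    refine ⟨c • φ, h1.const_smul c, h2.smul_left (f := fun _ => c),
      (closure_mono (Function.support_const_smul_subset c φ)).trans h3, ?_, ?_⟩
    · exact (Lp.coeFn_smul _ _).trans (h4.const_smul c)
    · have h : gradient (c • φ) = c • gradient φ := by
        funext x
        simp only [gradient, Pi.smul_apply]
        rw [fderiv_const_smul (h1.differentiable (by simp) x), map_smul]
      rw [h]
      exact (Lp.coeFn_smul _ _).trans (h5.const_smul c)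

/-- The Sobolev space `H¹₀(Ω)`: the closure of `C_c^∞(Ω)` with respect to the `H¹` norm. An
element is stored as the pair `(u, ∇u)` of a function and its weak gradient; the weak gradient is
determined by the function. -/
def H10 {N : ℕ} (Ω : Set (RN N)) : Submodule ℝ (L2Pair Ω) := (testPairs Ω).topologicalClosure

namespace H10

variable {N : ℕ} {Ω : Set (RN N)}

/-- The underlying function of an element of `H¹₀(Ω)`. -/
def toFun (w : H10 Ω) : RN N → ℝ := (w : L2Pair Ω).fst

/-- The weak gradient of an element of `H¹₀(Ω)`. -/
def grad (w : H10 Ω) : RN N → RN N := (w : L2Pair Ω).snd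

end H10

/-- An element of `H¹₀(Ω)` is sign-definite if it is nonzero and does not change sign. -/
def IsSignDefinite {N : ℕ} {Ω : Set (RN N)} (w : H10 Ω) : Prop :=
  w ≠ 0 ∧ ((∀ᵐ x ∂(volume.restrict Ω), 0 ≤ H10.toFun w x) ∨
    (∀ᵐ x ∂(volume.restrict Ω), H10.toFun w x ≤ 0))

/-- The energy functional `Φ(u) = ∫_Ω (|∇u|² / 2 - F(x,u)) dx` on `H¹₀(Ω)`, where
`F(x,t) = ∫_0^t f(x,s) ds`. -/
def energy {N : ℕ} (Ω : Set (RN N)) (f : RN N → ℝ → ℝ) (w : H10 Ω) : ℝ :=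
  ∫ x in Ω, ((1 / 2 : ℝ) * ‖H10.grad w x‖ ^ 2 - ∫ s in (0 : ℝ)..(H10.toFun w x), f x s)

end

/-! Lack of symmetry yields two points x₁, y₁ of Ω with equal norm and equal inner product with P at
which u₀ differs. The reflection σ in the hyperplane orthogonal to e = x₁ - y₁ fixes O and P and
exchanges x₁ and y₁. Since Ω and f are radial, u₀ ∘ σ solves the same equation, so w = u₀ - u₀ ∘ σ
is odd under σ, vanishes on ∂Ω and on the hyperplane, satisfies |Δw| ≤ K|w|, has a critical point at
P and is not identically zero. If w were nonpositive on one half of Ω, the strong maximum principle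
would make it negative there, and Hopf's lemma would give it a nonzero derivative at P. The same
holds for -w, so by oddness w is positive somewhere on both sides (`exists_pos_of_critical_point`).

Let p and q be the positive part of w on the two halves, extended by zero, and let V be their span.
The supports are disjoint up to null sets, so Φ(u₀ + sp + tq) - Φ(u₀) splits into two integrals.
Green's identity turns ∫∇u₀·∇p into the integral of f(x,u₀)w, and ∫|∇p|² into that of (f(x,u₀) -
f(x,u₀-w))w, both over the set where p is positive. The density of the increment is therefore m
f(u₀)w + (m²/2)(f(u₀) - f(u₀-w))w - (F(u₀+mw) - F(u₀)), with m = s or m = t. The secant of the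
convex function f through u₀-w and u₀ lies above f between these points and below f beyond u₀.
Integrating from u₀ in either direction shows that the density is nonpositive for all m ≥ -1
(`ConvexOn.le_integral_increment`). Only values ≥ u₀-w = u₀ ∘ σ occur, which is why convexity on
[0,∞) suffices when u₀ ≥ 0.

The remaining work is functional-analytic: {w > 0} has no regular boundary, so membership in H¹₀ and
integration by parts come from a C¹ truncation with compact support (`H10.exists_of_pos`). -/

noncomputable section

set_option linter.unusedSectionVars false

/-! ### Laplacian calculus, Hopf's lemma and the strong maximum principle. -/

section Elliptic

variable {E : Type*} [NormedAddCommGroup E] [InnerProductSpace ℝ E] [FiniteDimensional ℝ E]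

lemma ContDiffAt.fderiv_fderiv_apply {u : E → ℝ} {x : E} (hu : ContDiffAt ℝ 2 u x) (v w : E) :
    fderiv ℝ (fun y => fderiv ℝ u y v) x w = fderiv ℝ (fderiv ℝ u) x w v := by
  have h : DifferentiableAt ℝ (fderiv ℝ u) x :=
    (hu.fderiv_right (m := 1) (by norm_num)).differentiableAt (by norm_num)
  rw [fderiv_clm_apply h (differentiableAt_const v)]
  simp

lemma laplacian_eq_sum_fderiv {ι : Type*} [Fintype ι] (b : OrthonormalBasis ι ℝ E) {u : E → ℝ}
    {x : E} (hu : ContDiffAt ℝ 2 u x) :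
    Laplacian.laplacian u x = ∑ i, fderiv ℝ (fun y => fderiv ℝ u y (b i)) x (b i) := by
  rw [InnerProductSpace.laplacian_eq_iteratedFDeriv_orthonormalBasis u b]
  refine Finset.sum_congr rfl fun i _ => ?_
  rw [iteratedFDeriv_two_apply, hu.fderiv_fderiv_apply]
  simp

lemma continuousOn_laplacian {u : E → ℝ} {U : Set E} (hU : IsOpen U) (hu : ContDiffOn ℝ 2 u U) :
    ContinuousOn (Laplacian.laplacian u) U := by
  rw [InnerProductSpace.laplacian_eq_iteratedFDeriv_stdOrthonormalBasis]
  intro x hx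
  refine ContinuousAt.continuousWithinAt ?_
  have h2 : ContDiffAt ℝ 2 u x := hu.contDiffAt (hU.mem_nhds hx)
  have h : ContinuousAt (iteratedFDeriv ℝ 2 u) x :=
    ContDiffAt.continuousAt_iteratedFDeriv h2 (by norm_num)
  refine tendsto_finsetSum _ fun i _ => ?_
  exact (ContinuousMultilinearMap.apply ℝ (fun _ : Fin 2 => E) ℝ _).continuous.continuousAt.comp h

/-- On the line through the point in direction `v`, a negative second derivative would make the
minimum a local maximum too. The restriction would then be locally constant, with second derivative
zero. -/
lemma fderiv_fderiv_nonneg_of_isLocalMin {u : E → ℝ} {x : E} (hu : ContDiffAt ℝ 2 u x)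
    (hmin : IsLocalMin u x) (v : E) : 0 ≤ fderiv ℝ (fun y => fderiv ℝ u y v) x v := by
  by_contra! hneg
  set l : ℝ → E := fun t => x + t • v with hl
  have hl0 : l 0 = x := by simp [hl]
  have hld : ∀ t, HasDerivAt l v t := fun t => by
    have h := ((hasDerivAt_id t).smul_const v).const_add x
    rw [one_smul] at h
    exact h
  have hlc : Tendsto l (𝓝 0) (𝓝 x) := by
    have := (hld 0).continuousAt.tendsto
    rwa [hl0] at this
  have hd1 : ∀ᶠ t in 𝓝 (0 : ℝ), deriv (u ∘ l) t = fderiv ℝ u (l t) v := by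
    have h1 : ∀ᶠ y in 𝓝 x, DifferentiableAt ℝ u y := by
      filter_upwards [hu.eventually (by norm_num)] with y hy
      exact hy.differentiableAt (by norm_num)
    filter_upwards [hlc.eventually h1] with t ht
    exact (ht.hasFDerivAt.comp_hasDerivAt t (hld t)).deriv
  have hd2 : HasDerivAt (fun t => fderiv ℝ u (l t) v)
      (fderiv ℝ (fun y => fderiv ℝ u y v) x v) 0 := by
    have h1 : ContDiffAt ℝ 1 (fun y => fderiv ℝ u y v) x :=
      (hu.fderiv_right (m := 1) (by norm_num)).clm_apply contDiffAt_const
    have h2 := (h1.differentiableAt (by norm_num)).hasFDerivAt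
    rw [← hl0] at h2
    have h3 := h2.comp_hasDerivAt 0 (hld 0)
    rwa [hl0] at h3
  have hdd : deriv (deriv (u ∘ l)) 0 = fderiv ℝ (fun y => fderiv ℝ u y v) x v := by
    have : deriv (u ∘ l) =ᶠ[𝓝 0] fun t => fderiv ℝ u (l t) v := hd1
    rw [this.deriv_eq, hd2.deriv]
  have hlm : IsLocalMin (u ∘ l) 0 := by
    have : IsLocalMin u (l 0) := by rwa [hl0]
    exact this.comp_continuous (hld 0).continuousAt
  have hc : ContinuousAt (u ∘ l) 0 := by
    refine ContinuousAt.comp ?_ (hld 0).continuousAt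
    rw [hl0]; exact hu.continuousAt
  have hlM : IsLocalMax (u ∘ l) 0 :=
    isLocalMax_of_deriv_deriv_neg (by rwa [hdd]) hlm.deriv_eq_zero hc
  have hconst : (u ∘ l) =ᶠ[𝓝 0] fun _ => (u ∘ l) 0 := by
    filter_upwards [hlm, hlM] with t h1 h2
    exact le_antisymm h2 h1
  have : deriv (deriv (u ∘ l)) 0 = 0 := by
    have h := hconst.deriv
    rw [h.deriv_eq]
    simp
  linarith [hdd ▸ this]

lemma laplacian_nonneg_of_isLocalMin {u : E → ℝ} {x : E} (hu : ContDiffAt ℝ 2 u x)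
    (hmin : IsLocalMin u x) : 0 ≤ Laplacian.laplacian u x := by
  rw [laplacian_eq_sum_fderiv (stdOrthonormalBasis ℝ E) hu]
  exact Finset.sum_nonneg fun i _ => fderiv_fderiv_nonneg_of_isLocalMin hu hmin _

lemma fderiv_comp_isometry {u : E → ℝ} (σ : E ≃ₗᵢ[ℝ] E) (x v : E) :
    fderiv ℝ (u ∘ σ) x v = fderiv ℝ u (σ x) (σ v) := by
  have h := σ.toContinuousLinearEquiv.comp_right_fderiv (f := u) (x := x)
  have h' : fderiv ℝ (u ∘ σ) x =
    (fderiv ℝ u (σ x)).comp (σ.toContinuousLinearEquiv : E →L[ℝ] E) := h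
  rw [h']; rfl

/-- An isometry carries an orthonormal basis to an orthonormal basis, and the Laplacian may be
computed in either. -/
lemma laplacian_comp_isometry {u : E → ℝ} (σ : E ≃ₗᵢ[ℝ] E) {x : E}
    (hu : ContDiffAt ℝ 2 u (σ x)) :
    Laplacian.laplacian (u ∘ σ) x = Laplacian.laplacian u (σ x) := by
  have hσ : ContDiffAt ℝ 2 (u ∘ σ) x :=
    hu.comp x (σ.toContinuousLinearEquiv.contDiff.contDiffAt)
  rw [laplacian_eq_sum_fderiv (stdOrthonormalBasis ℝ E) hσ,
    laplacian_eq_sum_fderiv ((stdOrthonormalBasis ℝ E).map σ) hu]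
  refine Finset.sum_congr rfl fun i _ => ?_
  have : (fun y => fderiv ℝ (u ∘ σ) y (stdOrthonormalBasis ℝ E i)) =
      (fun y => fderiv ℝ u y (σ (stdOrthonormalBasis ℝ E i))) ∘ σ := by
    funext y
    exact fderiv_comp_isometry σ y _
  rw [this, fderiv_comp_isometry]
  simp

/-- The exponential barrier of the Hopf lemma. -/
def gaussianBarrier (α : ℝ) (y x : E) : ℝ := Real.exp (-α * ‖x - y‖ ^ 2)

lemma contDiff_gaussianBarrier (α : ℝ) (y : E) : ContDiff ℝ 2 (gaussianBarrier α y) := by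
  unfold gaussianBarrier
  exact (contDiff_const.mul ((contDiff_id.sub contDiff_const).norm_sq ℝ)).exp

lemma hasFDerivAt_gaussianBarrier (α : ℝ) (y x : E) :
    HasFDerivAt (gaussianBarrier α y)
      ((-2 * α * gaussianBarrier α y x) • innerSL ℝ (x - y)) x := by
  unfold gaussianBarrier
  have h1 : HasFDerivAt (fun x : E => ‖x - y‖ ^ 2) (2 • (innerSL ℝ (x - y))) x := by
    simpa using ((hasFDerivAt_id x).sub_const y).norm_sq
  convert (h1.const_mul (-α)).exp using 1
  ext v
  simp
  ring

/-- Away from the centre the α² term dominates for large α, so the barrier is a strict subsolution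
of Δ - K there. -/
lemma laplacian_gaussianBarrier (α : ℝ) (y x : E) :
    Laplacian.laplacian (gaussianBarrier α y) x =
      (4 * α ^ 2 * ‖x - y‖ ^ 2 - 2 * α * Module.finrank ℝ E) * gaussianBarrier α y x := by
  set b := stdOrthonormalBasis ℝ E
  rw [laplacian_eq_sum_fderiv b (contDiff_gaussianBarrier α y).contDiffAt]
  have h : ∀ i, fderiv ℝ (fun z => fderiv ℝ (gaussianBarrier α y) z (b i)) x (b i) =
      4 * α ^ 2 * gaussianBarrier α y x * ‖inner ℝ (b i) (x - y)‖ ^ 2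
        - 2 * α * gaussianBarrier α y x := by
    intro i
    have h1 : (fun z => fderiv ℝ (gaussianBarrier α y) z (b i)) =
        fun z => -2 * α * (gaussianBarrier α y z * inner ℝ (b i) (z - y)) := by
      funext z
      rw [(hasFDerivAt_gaussianBarrier α y z).fderiv]
      simp only [FunLike.coe_smul, Pi.smul_apply, innerSL_apply_apply, smul_eq_mul,
        real_inner_comm (z - y)]
      ring
    have h2 : HasFDerivAt (fun z => inner ℝ (b i) (z - y)) (innerSL ℝ (b i)) x := by
      exact (innerSL ℝ (b i)).hasFDerivAt.comp x ((hasFDerivAt_id x).sub_const y)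
    have h4 := ((hasFDerivAt_gaussianBarrier α y x).mul h2).const_mul (-2 * α)
    rw [h1, HasFDerivAt.fderiv (f := fun z => -2 * α * (gaussianBarrier α y z *
      inner ℝ (b i) (z - y))) h4]
    have h3 : inner ℝ (b i) (b i) = (1 : ℝ) := by
      rw [real_inner_self_eq_norm_sq, b.norm_eq_one]; norm_num
    simp only [FunLike.coe_smul, Pi.smul_apply, FunLike.coe_add, Pi.add_apply,
      innerSL_apply_apply, smul_eq_mul, real_inner_comm (x - y), h3, Real.norm_eq_abs, sq_abs]
    ring
  rw [Finset.sum_congr rfl fun i _ => h i, Finset.sum_sub_distrib, ← Finset.mul_sum,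
    b.sum_sq_norm_inner_right]
  simp
  ring

/-- Hopf's boundary point lemma for the operator `Δ - K` on a ball. -/
theorem fderiv_ne_zero_of_boundary_zero {w : E → ℝ} {U : Set E} {y z : E} {K : ℝ} (hU : IsOpen U)
    (hw : ContDiffOn ℝ 2 w U) (hK : 0 ≤ K) (hyz : y ≠ z)
    (hball : Metric.closedBall y (dist z y) ⊆ U)
    (hlap : ∀ x ∈ Metric.ball y (dist z y), Laplacian.laplacian w x ≤ K * w x)
    (hpos : ∀ x ∈ Metric.ball y (dist z y), 0 < w x) (hz : w z = 0) : fderiv ℝ w z ≠ 0 := by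
  intro hzero
  set ρ := dist z y with hρdef
  have hρ : 0 < ρ := dist_pos.2 hyz.symm
  have hnz : ‖z - y‖ = ρ := (dist_eq_norm z y).symm
  -- Where ‖x - y‖ ≥ ρ/2 one has 4α²‖x - y‖² ≥ α²ρ², so this α makes the barrier a strict
  -- subsolution on the outer half of the ball.
  obtain ⟨α, hα0, hα⟩ : ∃ α : ℝ, 0 < α ∧ K < α ^ 2 * ρ ^ 2 - 2 * α * Module.finrank ℝ E := by
    have h1 : Tendsto (fun α : ℝ => α * (α * ρ ^ 2 - 2 * Module.finrank ℝ E)) atTop atTop :=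
      tendsto_id.atTop_mul_atTop₀ (tendsto_atTop_add_const_right _ _
        (tendsto_id.atTop_mul_const (by positivity)))
    obtain ⟨α, h2, h3⟩ := ((h1.eventually_gt_atTop K).and (eventually_gt_atTop 0)).exists
    exact ⟨α, h3, by linarith⟩
  set c : ℝ := Real.exp (-α * ρ ^ 2) with hc
  have hcpos : 0 < c := Real.exp_pos _
  have hbar1 : ∀ x, gaussianBarrier α y x ≤ 1 := fun x => by
    unfold gaussianBarrier
    refine Real.exp_le_one_iff.2 ?_
    nlinarith [mul_nonneg hα0.le (sq_nonneg ‖x - y‖)]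
  have hwc : ContinuousOn w (Metric.closedBall y ρ) := hw.continuousOn.mono hball
  have hwnn : ∀ x ∈ Metric.closedBall y ρ, 0 ≤ w x := by
    intro x hx
    have hcl : closure (Metric.ball y ρ) = Metric.closedBall y ρ := closure_ball y hρ.ne'
    rw [← hcl] at hx hwc
    have := hwc.image_closure (mem_image_of_mem w hx)
    have h2 : closure (w '' Metric.ball y ρ) ⊆ Ici 0 :=
      closure_minimal (by rintro _ ⟨x, hx, rfl⟩; exact (hpos x hx).le) isClosed_Ici
    exact h2 this
  -- On the inner half ball the barrier need not be a subsolution. There its size is at most 1, and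
  -- `m`, the minimum of `w`, suffices for the comparison.
  obtain ⟨m, hm0, hm⟩ : ∃ m : ℝ, 0 < m ∧ ∀ x ∈ Metric.closedBall y (ρ / 2), m ≤ w x := by
    obtain ⟨x₀, hx₀, hmin⟩ := (isCompact_closedBall y (ρ / 2)).exists_isMinOn
      ⟨y, Metric.mem_closedBall_self (by positivity)⟩
      (hwc.mono (Metric.closedBall_subset_closedBall (by linarith)))
    refine ⟨w x₀, hpos _ (Metric.closedBall_subset_ball (by linarith) hx₀), fun x hx => hmin hx⟩
  set g : E → ℝ := fun x => w x - m * (gaussianBarrier α y x - c) with hg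
  have hbcont : Continuous (gaussianBarrier α y) := (contDiff_gaussianBarrier α y).continuous
  have hgc : ContinuousOn g (Metric.closedBall y ρ) :=
    hwc.sub (continuous_const.mul (hbcont.sub continuous_const)).continuousOn
  -- A negative minimum of `g` cannot lie in the inner half ball (choice of `m`) or on the sphere
  -- (where the barrier equals `c`). In between, Δg ≥ 0 contradicts the strict subsolution property.
  have hgnn : ∀ x ∈ Metric.closedBall y ρ, 0 ≤ g x := by
    obtain ⟨x₀, hx₀, hmin⟩ := (isCompact_closedBall y ρ).exists_isMinOn
      ⟨y, Metric.mem_closedBall_self hρ.le⟩ hgc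
    suffices h : 0 ≤ g x₀ from fun x hx => h.trans (hmin hx)
    by_contra! hneg
    have hd : ‖x₀ - y‖ ≤ ρ := by rw [← dist_eq_norm]; exact hx₀
    rcases le_or_gt ‖x₀ - y‖ (ρ / 2) with h1 | h1
    · have h2 := hm x₀ (by rw [Metric.mem_closedBall, dist_eq_norm]; exact h1)
      have h3 := hbar1 x₀
      simp only [hg] at hneg
      nlinarith
    rcases hd.eq_or_lt with h2 | h2
    · have h3 : gaussianBarrier α y x₀ = c := by rw [gaussianBarrier, h2]
      have h4 := hwnn x₀ hx₀
      simp only [hg, h3] at hneg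
      linarith
    have hx₀b : x₀ ∈ Metric.ball y ρ := by rw [Metric.mem_ball, dist_eq_norm]; exact h2
    have hloc : IsLocalMin g x₀ := by
      filter_upwards [Metric.isOpen_ball.mem_nhds hx₀b] with x hx
      exact hmin (Metric.ball_subset_closedBall hx)
    have hwx : ContDiffAt ℝ 2 w x₀ := hw.contDiffAt (hU.mem_nhds (hball hx₀))
    have hbx : ContDiffAt ℝ 2 (gaussianBarrier α y) x₀ :=
      (contDiff_gaussianBarrier α y).contDiffAt
    have hcx : ContDiffAt ℝ 2 (fun _ : E => -c) x₀ := contDiffAt_const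
    have hsx : ContDiffAt ℝ 2 (gaussianBarrier α y + fun _ : E => -c) x₀ := hbx.add hcx
    have hgeq : g = w - m • (gaussianBarrier α y + fun _ : E => -c) := by
      funext x; simp only [hg, Pi.sub_apply, Pi.smul_apply, Pi.add_apply, smul_eq_mul]; ring
    have hlapg := laplacian_nonneg_of_isLocalMin (u := g)
      (by rw [hgeq]; exact hwx.sub (hsx.const_smul m)) hloc
    rw [hgeq, hwx.laplacian_sub (f₂ := m • _) (hsx.const_smul m), InnerProductSpace.laplacian_smul m hsx,
      hbx.laplacian_add hcx, InnerProductSpace.laplacian_const, laplacian_gaussianBarrier] at hlapg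
    have h5 := hlap x₀ hx₀b
    have hbpos : 0 < gaussianBarrier α y x₀ := Real.exp_pos _
    have h6 : K < 4 * α ^ 2 * ‖x₀ - y‖ ^ 2 - 2 * α * Module.finrank ℝ E := by
      have : (ρ / 2) ^ 2 ≤ ‖x₀ - y‖ ^ 2 := by gcongr
      nlinarith [sq_nonneg α]
    have h7 : K * gaussianBarrier α y x₀ <
        (4 * α ^ 2 * ‖x₀ - y‖ ^ 2 - 2 * α * Module.finrank ℝ E) * gaussianBarrier α y x₀ :=
      mul_lt_mul_of_pos_right h6 hbpos
    have h8 : K * g x₀ ≤ 0 := mul_nonpos_of_nonneg_of_nonpos hK hneg.le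
    simp only [hg, smul_eq_mul, Pi.zero_apply, add_zero] at h8 hlapg
    have h9 := mul_lt_mul_of_pos_left h7 hm0
    have h10 : 0 ≤ K * m * c := by positivity
    nlinarith
  -- Along the segment from `z` to the centre, `g` starts at 0 and stays nonnegative. If the
  -- derivative of `w` vanished, the barrier would give `g` the slope -2mαcρ² < 0.
  set l : ℝ → E := fun t => z + t • (y - z) with hl
  have hl0 : l 0 = z := by simp [hl]
  have hld : HasDerivAt l (y - z) 0 := by
    have h := ((hasDerivAt_id (0 : ℝ)).smul_const (y - z)).const_add z
    rw [one_smul] at h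
    exact h
  have hwz : HasFDerivAt w (0 : E →L[ℝ] ℝ) z := by
    rw [← hzero]
    refine ((hw.contDiffAt (hU.mem_nhds (hball ?_))).differentiableAt (by norm_num)).hasFDerivAt
    exact Metric.mem_closedBall.2 le_rfl
  have hbz : gaussianBarrier α y z = c := by rw [gaussianBarrier, hnz]
  have hgz : HasFDerivAt g (0 - m • ((-2 * α * c) • innerSL ℝ (z - y))) z := by
    have h := hasFDerivAt_gaussianBarrier α y z
    rw [hbz] at h
    exact hwz.sub ((h.sub_const c).const_mul m)
  rw [← hl0] at hgz
  have hder := hgz.comp_hasDerivAt 0 hld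
  have hval : (0 - m • ((-2 * α * c) • innerSL ℝ (l 0 - y))) (y - z) = -(2 * m * α * c * ρ ^ 2) := by
    have : inner ℝ (z - y) (y - z) = -ρ ^ 2 := by
      rw [← neg_sub z y, inner_neg_right, real_inner_self_eq_norm_sq, hnz]
    rw [hl0]
    simp only [FunLike.coe_sub, Pi.sub_apply, FunLike.coe_smul, Pi.smul_apply,
      innerSL_apply_apply, smul_eq_mul, this, FunLike.coe_zero, Pi.zero_apply]
    ring
  rw [hval] at hder
  have hlim := hder.tendsto_slope_zero_right
  have hge : 0 ≤ -(2 * m * α * c * ρ ^ 2) := by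
    refine ge_of_tendsto hlim ?_
    have h1 : ∀ᶠ t in 𝓝[>] (0 : ℝ), t ∈ Ioo (0 : ℝ) 1 :=
      Ioo_mem_nhdsGT one_pos
    filter_upwards [h1] with t ht
    have h2 : l t ∈ Metric.closedBall y ρ := by
      have : l t - y = (1 - t) • (z - y) := by simp only [hl]; module
      rw [Metric.mem_closedBall, dist_eq_norm, this, norm_smul, hnz, Real.norm_eq_abs,
        abs_of_pos (by linarith [ht.2])]
      nlinarith [ht.1]
    have h3 : (g ∘ l) 0 = 0 := by simp [hl0, hg, hz, hbz]
    rw [zero_add, h3, sub_zero]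
    exact mul_nonneg (inv_nonneg.2 ht.1.le) (hgnn _ h2)
  have : 0 < 2 * m * α * c * ρ ^ 2 := by positivity
  linarith

/-- Strong maximum principle for the operator `Δ - K`. -/
theorem pos_or_eq_zero_of_laplacian_le {w : E → ℝ} {U : Set E} {K : ℝ} (hU : IsOpen U)
    (hUc : IsPreconnected U) (hw : ContDiffOn ℝ 2 w U) (hK : 0 ≤ K)
    (hlap : ∀ x ∈ U, Laplacian.laplacian w x ≤ K * w x) (hnn : ∀ x ∈ U, 0 ≤ w x) :
    (∀ x ∈ U, 0 < w x) ∨ ∀ x ∈ U, w x = 0 := by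
  have hposopen : IsOpen (U ∩ w ⁻¹' Ioi 0) := hw.continuousOn.isOpen_inter_preimage hU isOpen_Ioi
  -- A zero nearest to a point `y` with `w y > 0` lies on the boundary of a ball on which `w` is
  -- positive. It is an interior minimum with zero derivative, against Hopf's lemma.
  have hzopen : IsOpen (U ∩ w ⁻¹' {0}) := by
    rw [Metric.isOpen_iff]
    rintro z₀ ⟨hz₀U, hz₀⟩
    obtain ⟨r, hr, hrU⟩ := Metric.isOpen_iff.1 hU z₀ hz₀U
    -- The nearest zero is within r/3 of `y`, and `y` within r/3 of `z₀`, so the ball around `y`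
    -- stays in the closed ball of radius 2r/3.
    refine ⟨r / 3, by positivity, fun y hy => ?_⟩
    have hyU : y ∈ U := hrU (Metric.ball_subset_ball (by linarith) hy)
    refine ⟨hyU, ?_⟩
    by_contra hne
    have hy0 : 0 < w y := lt_of_le_of_ne (hnn y hyU) (Ne.symm hne)
    set Z := Metric.closedBall z₀ (2 * r / 3) ∩ w ⁻¹' {0} with hZ
    have hbU : Metric.closedBall z₀ (2 * r / 3) ⊆ U :=
      (Metric.closedBall_subset_ball (by linarith)).trans hrU
    have hZc : IsCompact Z :=
      (isCompact_closedBall _ _).of_isClosed_subset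
        ((hw.continuousOn.mono hbU).preimage_isClosed_of_isClosed Metric.isClosed_closedBall
          isClosed_singleton) inter_subset_left
    have hz₀Z : z₀ ∈ Z := ⟨Metric.mem_closedBall_self (by positivity), hz₀⟩
    obtain ⟨z, hz, hzmin⟩ := hZc.exists_infDist_eq_dist ⟨z₀, hz₀Z⟩ y
    have hdz : dist z y ≤ dist z₀ y := by
      rw [dist_comm z, ← hzmin, dist_comm z₀]
      exact Metric.infDist_le_dist_of_mem hz₀Z
    have hy' : dist z₀ y < r / 3 := by rw [dist_comm]; exact hy
    have hcb : Metric.closedBall y (dist z y) ⊆ Metric.closedBall z₀ (2 * r / 3) := by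
      refine Metric.closedBall_subset_closedBall' ?_
      rw [dist_comm y]; linarith
    have hpos : ∀ x ∈ Metric.ball y (dist z y), 0 < w x := by
      intro x hx
      have hxc := hcb (Metric.ball_subset_closedBall hx)
      refine lt_of_le_of_ne (hnn x (hbU hxc)) fun h0 => ?_
      have h1 : Metric.infDist y Z ≤ dist y x := Metric.infDist_le_dist_of_mem ⟨hxc, h0.symm⟩
      rw [hzmin, dist_comm y z, dist_comm y x] at h1
      exact absurd hx (not_lt.2 h1)
    have hyz : y ≠ z := by
      rintro rfl
      exact hne hz.2
    refine fderiv_ne_zero_of_boundary_zero hU hw hK hyz (hcb.trans hbU)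
      (fun x hx => hlap x (hbU (hcb (Metric.ball_subset_closedBall hx)))) hpos hz.2 ?_
    have hmin : IsLocalMin w z := by
      filter_upwards [hU.mem_nhds (hbU hz.1)] with x hx
      rw [show w z = 0 from hz.2]
      exact hnn x hx
    exact hmin.fderiv_eq_zero
  have hcover : U ⊆ (U ∩ w ⁻¹' Ioi 0) ∪ (U ∩ w ⁻¹' {0}) := fun x hx => by
    rcases (hnn x hx).eq_or_lt with h | h
    · exact Or.inr ⟨hx, h.symm⟩
    · exact Or.inl ⟨hx, h⟩
  have hdisj : Disjoint (U ∩ w ⁻¹' Ioi 0) (U ∩ w ⁻¹' {0}) := by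
    rw [Set.disjoint_left]
    rintro x ⟨_, h1⟩ ⟨_, h2⟩
    rw [mem_preimage, mem_singleton_iff] at h2
    rw [mem_preimage, h2] at h1
    exact lt_irrefl (0 : ℝ) h1
  by_cases hne : (U ∩ (U ∩ w ⁻¹' Ioi 0)).Nonempty
  · exact Or.inl fun x hx => (hUc.subset_left_of_subset_union hposopen hzopen hdisj hcover hne hx).2
  · refine Or.inr fun x hx => ?_
    rcases hcover hx with h | h
    · exact absurd ⟨x, hx, h⟩ hne
    · exact h.2

end Elliptic

/-! ### Geometry of balls and annuli. -/

namespace IsBallOrAnnulus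

variable {N : ℕ} {Ω : Set (RN N)}

lemma isOpen (h : IsBallOrAnnulus Ω) : IsOpen Ω := by
  rcases h with ⟨R, _, rfl⟩ | ⟨a, b, _, _, rfl⟩
  · exact Metric.isOpen_ball
  · exact (isOpen_lt continuous_const continuous_norm).inter
      (isOpen_lt continuous_norm continuous_const)

lemma isBounded (h : IsBallOrAnnulus Ω) : Bornology.IsBounded Ω := by
  rcases h with ⟨R, _, rfl⟩ | ⟨a, b, _, _, rfl⟩
  · exact Metric.isBounded_ball
  · refine Metric.isBounded_ball (x := (0 : RN N)) (r := b) |>.subset fun x hx => ?_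
    simpa using hx.2

lemma mem_of_norm_eq (h : IsBallOrAnnulus Ω) {x y : RN N} (hx : x ∈ Ω) (hxy : ‖y‖ = ‖x‖) :
    y ∈ Ω := by
  rcases h with ⟨R, _, rfl⟩ | ⟨a, b, _, _, rfl⟩
  · simpa [hxy] using hx
  · simpa [hxy] using hx

/-- A half annulus is not convex, but it is the continuous image, under rescaling z to length r, of
the convex set of pairs (r, z) with r in an interval and z in the open half-space. The half-space
excludes the origin, so the ball is the case a = 0. -/
lemma isPreconnected_inter_halfSpace (h : IsBallOrAnnulus Ω) (e : RN N) :
    IsPreconnected (Ω ∩ {x | 0 < inner ℝ x e}) := by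
  obtain ⟨a, b, ha, hab⟩ : ∃ a b : ℝ, 0 ≤ a ∧ ∀ x : RN N, x ≠ 0 → (x ∈ Ω ↔ a < ‖x‖ ∧ ‖x‖ < b) := by
    rcases h with ⟨R, _, rfl⟩ | ⟨a, b, ha, _, rfl⟩
    · exact ⟨0, R, le_rfl, fun x hx => by simp [hx]⟩
    · exact ⟨a, b, ha.le, fun x _ => Iff.rfl⟩
  have hne : ∀ x : RN N, 0 < inner ℝ x e → x ≠ 0 := by
    rintro x hx rfl
    simp at hx
  have hconv : Convex ℝ {x : RN N | 0 < inner ℝ x e} := by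
    intro x hx y hy s t hs ht hst
    simp only [mem_ofPred_eq] at hx hy ⊢
    rw [inner_add_left, real_inner_smul_left, real_inner_smul_left]
    rcases hs.eq_or_lt with rfl | hs
    · have : t = 1 := by linarith
      subst this
      linarith
    · have := mul_pos hs hx
      have := mul_nonneg ht hy.le
      linarith
  have himage : Ω ∩ {x | 0 < inner ℝ x e} =
      (fun p : ℝ × RN N => (p.1 / ‖p.2‖) • p.2) '' (Ioo a b ×ˢ {x | 0 < inner ℝ x e}) := by
    ext x
    constructor
    · rintro ⟨hx, hxe⟩
      refine ⟨(‖x‖, x), ⟨(hab x (hne x hxe)).1 hx, hxe⟩, ?_⟩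
      have : ‖x‖ ≠ 0 := norm_ne_zero_iff.2 (hne x hxe)
      simp [div_self this]
    · rintro ⟨⟨r, z⟩, ⟨hr, hz⟩, rfl⟩
      have hz0 : 0 < ‖z‖ := norm_pos_iff.2 (hne z hz)
      have hr0 : 0 < r := ha.trans_lt hr.1
      have hin : 0 < inner ℝ ((r / ‖z‖) • z) e := by
        rw [real_inner_smul_left]
        exact mul_pos (div_pos hr0 hz0) hz
      refine ⟨(hab _ (hne _ hin)).2 ?_, hin⟩
      have : ‖(r / ‖z‖) • z‖ = r := by
        rw [norm_smul, norm_div, norm_norm, div_mul_cancel₀ _ hz0.ne', Real.norm_of_nonneg hr0.le]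
      rw [this]
      exact hr
  rw [himage]
  refine ((convex_Ioo a b).isPreconnected.prod hconv.isPreconnected).image _ ?_
  refine ContinuousOn.smul (continuousOn_fst.div continuousOn_snd.norm ?_) continuousOn_snd
  rintro ⟨r, z⟩ ⟨_, hz⟩
  exact norm_ne_zero_iff.2 (hne z hz)

end IsBallOrAnnulus

/-! ### Sign of a solution of a linear equation on a half domain with a critical point on the
hyperplane. -/

section Reflection

variable {N : ℕ} {Ω : Set (RN N)}

/-- A function solving a linear equation on `Ω` which vanishes on the hyperplane `eᗮ` and has a
critical point there takes positive values on each side of it, unless it vanishes there. -/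
theorem exists_pos_of_critical_point (hΩ : IsBallOrAnnulus Ω) {e P : RN N} (he : e ≠ 0)
    {w : RN N → ℝ} (hw : ContDiffOn ℝ 2 w Ω) {K : ℝ} (hK : 0 ≤ K)
    (hlap : ∀ x ∈ Ω, |Laplacian.laplacian w x| ≤ K * |w x|)
    (hP : P ∈ Ω) (hPe : inner ℝ P e = 0) (hwP : w P = 0) (hcrit : fderiv ℝ w P = 0)
    (hne : ∃ x ∈ Ω, 0 < inner ℝ x e ∧ w x ≠ 0) :
    ∃ x ∈ Ω, 0 < inner ℝ x e ∧ 0 < w x := by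
  by_contra! hcon
  set v : RN N → ℝ := -w with hv
  have hvnn : ∀ x ∈ Ω ∩ {x | 0 < inner ℝ x e}, 0 ≤ v x := fun x hx => by
    simpa [hv] using hcon x hx.1 hx.2
  have hvlap : ∀ x ∈ Ω ∩ {x | 0 < inner ℝ x e}, Laplacian.laplacian v x ≤ K * v x := by
    intro x hx
    have h1 := hlap x hx.1
    have h2 := hcon x hx.1 hx.2
    rw [abs_of_nonpos h2] at h1
    rw [hv, InnerProductSpace.laplacian_neg]
    exact (neg_le_abs _).trans h1
  have hopen : IsOpen (Ω ∩ {x | 0 < inner ℝ x e}) :=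
    hΩ.isOpen.inter (isOpen_lt continuous_const (continuous_id.inner continuous_const))
  have hpos : ∀ x ∈ Ω ∩ {x | 0 < inner ℝ x e}, 0 < v x := by
    rcases pos_or_eq_zero_of_laplacian_le hopen (hΩ.isPreconnected_inter_halfSpace e)
      (hw.neg.mono inter_subset_left) hK hvlap hvnn with h | h
    · exact h
    · obtain ⟨x, hx, hxe, hwx⟩ := hne
      exact absurd (neg_eq_zero.1 (h x ⟨hx, hxe⟩)) hwx
  obtain ⟨r, hr, hrΩ⟩ := Metric.isOpen_iff.1 hΩ.isOpen P hP
  have hepos : 0 < ‖e‖ := norm_pos_iff.2 he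
  -- The ball around P + te of radius t‖e‖ = r/3 touches the hyperplane at `P` and lies within 2r/3
  -- of `P`, hence in Ω.
  set t : ℝ := r / (3 * ‖e‖) with ht
  have ht0 : 0 < t := by positivity
  have htr : t * ‖e‖ = r / 3 := by rw [ht]; field_simp
  set y : RN N := P + t • e with hy
  have hd : dist P y = t * ‖e‖ := by
    rw [hy, dist_eq_norm, sub_add_cancel_left, norm_neg, norm_smul, Real.norm_of_nonneg ht0.le]
  have hcb : Metric.closedBall y (dist P y) ⊆ Ω := by
    refine subset_trans (fun x hx => ?_) hrΩ
    have h1 := dist_triangle x y P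
    rw [dist_comm y P] at h1
    rw [Metric.mem_closedBall] at hx
    rw [Metric.mem_ball]
    linarith
  have hball : Metric.ball y (dist P y) ⊆ Ω ∩ {x | 0 < inner ℝ x e} := by
    intro x hx
    refine ⟨hcb (Metric.ball_subset_closedBall hx), ?_⟩
    rw [Metric.mem_ball, hd, dist_eq_norm] at hx
    have h1 : inner ℝ x e = inner ℝ (x - y) e + t * ‖e‖ ^ 2 := by
      rw [inner_sub_left, hy, inner_add_left, hPe, real_inner_smul_left,
        real_inner_self_eq_norm_sq]
      ring
    have h2 := neg_le_of_abs_le (abs_real_inner_le_norm (x - y) e)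
    have h3 := mul_lt_mul_of_pos_right hx hepos
    simp only [mem_ofPred_eq, h1]
    nlinarith
  have hyP : y ≠ P := by
    intro h
    rw [h, dist_self] at hd
    have := mul_pos ht0 hepos
    linarith
  refine fderiv_ne_zero_of_boundary_zero hΩ.isOpen hw.neg hK hyP hcb
    (fun x hx => hvlap x (hball hx)) (fun x hx => hpos x (hball hx)) (by simp [hwP]) ?_
  rw [fderiv_fun_neg, hcrit, neg_zero]

end Reflection

/-! ### Smooth approximation of compactly supported C¹ functions. -/

section Mollification

lemma contDiff_of_contDiffAt_tsupport {E F : Type*} [NormedAddCommGroup E] [NormedSpace ℝ E]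
    [NormedAddCommGroup F] [NormedSpace ℝ F] {n : WithTop ℕ∞} {f : E → F}
    (h : ∀ x ∈ tsupport f, ContDiffAt ℝ n f x) : ContDiff ℝ n f := by
  rw [contDiff_iff_contDiffAt]
  intro x
  by_cases hx : x ∈ tsupport f
  · exact h x hx
  · exact contDiffAt_const.congr_of_eventuallyEq (notMem_tsupport_iff_eventuallyEq.1 hx)

variable {E : Type*} [NormedAddCommGroup E] [InnerProductSpace ℝ E] [FiniteDimensional ℝ E]
  [MeasurableSpace E] [BorelSpace E]

/-- Mollification: a compactly supported `C¹` function is a `C¹` limit of smooth functions with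
support in a given open neighbourhood of its support. -/
lemma exists_contDiff_approx {ψ : E → ℝ} (hψ : ContDiff ℝ 1 ψ) (hc : HasCompactSupport ψ)
    {U : Set E} (hU : IsOpen U) (hψU : tsupport ψ ⊆ U) {ε : ℝ} (hε : 0 < ε) :
    ∃ η : E → ℝ, ContDiff ℝ ∞ η ∧ HasCompactSupport η ∧ tsupport η ⊆ U ∧
      (∀ x, ‖η x - ψ x‖ ≤ ε) ∧ ∀ x, ‖fderiv ℝ η x - fderiv ℝ ψ x‖ ≤ ε := by
  have hfc : Continuous (fderiv ℝ ψ) := hψ.continuous_fderiv one_ne_zero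
  obtain ⟨δ₁, hδ₁, h₁⟩ := Metric.uniformContinuous_iff.1
    (hc.uniformContinuous_of_continuous hψ.continuous) ε hε
  obtain ⟨δ₂, hδ₂, h₂⟩ := Metric.uniformContinuous_iff.1
    ((hc.fderiv ℝ).uniformContinuous_of_continuous hfc) ε hε
  obtain ⟨δ₃, hδ₃, h₃⟩ := IsCompact.exists_cthickening_subset_open hc hU hψU
  obtain ⟨δ, hδ, hδ1, hδ2, hδ3⟩ : ∃ δ : ℝ, 0 < δ ∧ δ ≤ δ₁ ∧ δ ≤ δ₂ ∧ δ ≤ δ₃ :=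
    ⟨min δ₁ (min δ₂ δ₃), by positivity, min_le_left _ _,
      (min_le_right _ _).trans (min_le_left _ _), (min_le_right _ _).trans (min_le_right _ _)⟩
  let φ : ContDiffBump (0 : E) := ⟨δ / 2, δ, by positivity, by linarith⟩
  have hφ : LocallyIntegrable (φ.normed volume) (volume : Measure E) :=
    (φ.contDiff_normed (n := 0)).continuous.locallyIntegrable
  let L := ContinuousLinearMap.lsmul ℝ ℝ (E := ℝ)
  set η : E → ℝ := convolution (φ.normed volume) ψ L volume with hη
  have hder : ∀ x, fderiv ℝ η x = convolution (φ.normed volume) (fderiv ℝ ψ)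
      (ContinuousLinearMap.lsmul ℝ ℝ) volume x := by
    intro x
    rw [(hc.hasFDerivAt_convolution_right L hφ hψ x).fderiv]
    rfl
  have hsub : tsupport η ⊆ Metric.cthickening δ (tsupport ψ) := by
    refine closure_minimal ?_ Metric.isClosed_cthickening
    refine (support_convolution_subset L).trans ?_
    rw [φ.support_normed_eq]
    rintro _ ⟨a, ha, b, hb, rfl⟩
    refine Metric.mem_cthickening_of_dist_le _ b _ _ (subset_tsupport _ hb) ?_
    have : dist (a + b) b = dist a 0 := by simp [dist_eq_norm]
    simp only [this]
    exact (Metric.mem_ball.1 ha).le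
  refine ⟨η, ?_, ?_, ?_, ?_, ?_⟩
  · exact φ.hasCompactSupport_normed.contDiff_convolution_left L φ.contDiff_normed
      hψ.continuous.locallyIntegrable
  · exact IsCompact.of_isClosed_subset (IsCompact.cthickening hc) (isClosed_tsupport _) hsub
  · exact hsub.trans ((Metric.cthickening_mono hδ3 _).trans h₃)
  · intro x
    rw [← dist_eq_norm]
    refine ContDiffBump.dist_normed_convolution_le hψ.continuous.aestronglyMeasurable ?_
    intro y hy
    exact (h₁ (lt_of_lt_of_le hy hδ1)).le
  · intro x
    rw [← dist_eq_norm, hder]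
    refine ContDiffBump.dist_normed_convolution_le hfc.aestronglyMeasurable ?_
    intro y hy
    exact (h₂ (lt_of_lt_of_le hy hδ2)).le

end Mollification

/-! ### Dominated convergence in L². -/

section Dominated

variable {α F : Type*} [MeasurableSpace α] {μ : Measure α} [NormedAddCommGroup F]

/-- Dominated convergence in `L²`. -/
lemma tendsto_eLpNorm_two_of_dominated {f : ℕ → α → F} {g : α → F} {b : α → ℝ}
    (hf : ∀ n, AEStronglyMeasurable (f n) μ) (hg : AEStronglyMeasurable g μ) (hb : MemLp b 2 μ)
    (hle : ∀ n, ∀ᵐ x ∂μ, ‖f n x - g x‖ ≤ b x)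
    (hlim : ∀ᵐ x ∂μ, Tendsto (fun n => f n x) atTop (𝓝 (g x))) :
    Tendsto (fun n => eLpNorm (f n - g) 2 μ) atTop (𝓝 0) := by
  have h1 : ∀ n, eLpNorm (f n - g) 2 μ = (∫⁻ x, ‖(f n - g) x‖ₑ ^ (2 : ℝ) ∂μ) ^ (1 / (2 : ℝ)) := by
    intro n
    rw [eLpNorm_eq_lintegral_rpow_enorm_toReal two_ne_zero ENNReal.ofNat_ne_top]
    simp
  have h2 : Tendsto (fun n => ∫⁻ x, ‖(f n - g) x‖ₑ ^ (2 : ℝ) ∂μ) atTop (𝓝 (∫⁻ _, 0 ∂μ)) := by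
    refine tendsto_lintegral_of_dominated_convergence' (fun x => ‖b x‖ₑ ^ (2 : ℝ))
      (fun n => ((hf n).sub hg).enorm.pow_const _) (fun n => ?_) ?_ ?_
    · filter_upwards [hle n] with x hx
      refine ENNReal.rpow_le_rpow ?_ (by norm_num)
      rw [enorm_le_iff_norm_le]
      exact hx.trans (le_abs_self _)
    · have h3 := lintegral_rpow_enorm_lt_top_of_eLpNorm_lt_top two_ne_zero ENNReal.ofNat_ne_top
        hb.eLpNorm_lt_top
      simpa using h3.ne
    · filter_upwards [hlim] with x hx
      have h3 : Tendsto (fun n => ‖f n x - g x‖ₑ) atTop (𝓝 ‖g x - g x‖ₑ) :=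
        (hx.sub tendsto_const_nhds).enorm
      have h4 := h3.ennrpow_const 2
      simpa using h4
  have h5 := h2.ennrpow_const (1 / 2)
  simp only [lintegral_zero] at h5
  rw [ENNReal.zero_rpow_of_pos (by norm_num)] at h5
  exact h5.congr fun n => (h1 n).symm

end Dominated

/-! ### Basic properties of H¹₀ and its C¹ members. -/

namespace H10

variable {N : ℕ} {Ω : Set (RN N)}

lemma memLp_toFun (w : H10 Ω) : MemLp (toFun w) 2 (volume.restrict Ω) := Lp.memLp _

lemma memLp_grad (w : H10 Ω) : MemLp (grad w) 2 (volume.restrict Ω) := Lp.memLp _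

lemma toFun_add (v w : H10 Ω) : toFun (v + w) =ᵐ[volume.restrict Ω] toFun v + toFun w :=
  Lp.coeFn_add _ _

lemma toFun_sub (v w : H10 Ω) : toFun (v - w) =ᵐ[volume.restrict Ω] toFun v - toFun w :=
  Lp.coeFn_sub _ _

lemma toFun_smul (c : ℝ) (w : H10 Ω) : toFun (c • w) =ᵐ[volume.restrict Ω] c • toFun w :=
  Lp.coeFn_smul _ _

lemma inner_eq (v w : H10 Ω) : inner ℝ v w =
    (∫ x in Ω, inner ℝ (toFun v x) (toFun w x)) + ∫ x in Ω, inner ℝ (grad v x) (grad w x) := by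
  rw [Submodule.coe_inner, WithLp.prod_inner_apply, L2.inner_def, L2.inner_def]
  rfl

/-- `H¹₀` is closed under `L²` limits of functions and gradients. -/
lemma exists_of_tendsto {u : RN N → ℝ} {G : RN N → RN N} (w : ℕ → H10 Ω)
    (hu : MemLp u 2 (volume.restrict Ω)) (hG : MemLp G 2 (volume.restrict Ω))
    (h1 : Tendsto (fun n => eLpNorm (toFun (w n) - u) 2 (volume.restrict Ω)) atTop (𝓝 0))
    (h2 : Tendsto (fun n => eLpNorm (grad (w n) - G) 2 (volume.restrict Ω)) atTop (𝓝 0)) :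
    ∃ W : H10 Ω, toFun W =ᵐ[volume.restrict Ω] u ∧ grad W =ᵐ[volume.restrict Ω] G := by
  have hlim1 : Tendsto (fun n => (w n : L2Pair Ω).fst) atTop (𝓝 hu.toLp) := by
    rw [Lp.tendsto_Lp_iff_tendsto_eLpNorm']
    refine h1.congr fun n => eLpNorm_congr_ae ?_
    exact (EventuallyEq.refl _ (toFun (w n))).sub hu.coeFn_toLp.symm
  have hlim2 : Tendsto (fun n => (w n : L2Pair Ω).snd) atTop (𝓝 hG.toLp) := by
    rw [Lp.tendsto_Lp_iff_tendsto_eLpNorm']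
    refine h2.congr fun n => eLpNorm_congr_ae ?_
    exact (EventuallyEq.refl _ (grad (w n))).sub hG.coeFn_toLp.symm
  have hlim : Tendsto (fun n => (w n : L2Pair Ω)) atTop (𝓝 (WithLp.toLp 2 (hu.toLp, hG.toLp))) :=
    ((WithLp.prod_continuous_toLp 2 _ _).tendsto _).comp (hlim1.prodMk_nhds hlim2)
  have hmem : WithLp.toLp 2 (hu.toLp, hG.toLp) ∈ H10 Ω :=
    (Submodule.isClosed_topologicalClosure (testPairs Ω)).mem_of_tendsto hlim
      (Eventually.of_forall fun n => (w n).2)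
  exact ⟨⟨_, hmem⟩, hu.coeFn_toLp, hG.coeFn_toLp⟩

lemma continuous_gradient {ψ : RN N → ℝ} (hψ : ContDiff ℝ 1 ψ) : Continuous (gradient ψ) :=
  (InnerProductSpace.toDual ℝ (RN N)).symm.continuous.comp (hψ.continuous_fderiv one_ne_zero)

lemma hasCompactSupport_gradient {ψ : RN N → ℝ} (hc : HasCompactSupport ψ) :
    HasCompactSupport (gradient ψ) :=
  (hc.fderiv ℝ).comp_left (map_zero _)

lemma exists_of_test {φ : RN N → ℝ} (h1 : ContDiff ℝ ∞ φ) (h2 : HasCompactSupport φ)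
    (h3 : tsupport φ ⊆ Ω) :
    ∃ W : H10 Ω, toFun W =ᵐ[volume.restrict Ω] φ ∧ grad W =ᵐ[volume.restrict Ω] gradient φ := by
  have hφ1 : ContDiff ℝ 1 φ := h1.of_le (by exact_mod_cast le_top)
  have hm1 : MemLp φ 2 (volume.restrict Ω) := h1.continuous.memLp_of_hasCompactSupport h2
  have hm2 : MemLp (gradient φ) 2 (volume.restrict Ω) :=
    (continuous_gradient hφ1).memLp_of_hasCompactSupport (hasCompactSupport_gradient h2)
  have hmem : WithLp.toLp 2 (hm1.toLp, hm2.toLp) ∈ H10 Ω :=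
    Submodule.le_topologicalClosure _
      ⟨φ, h1, h2, h3, hm1.coeFn_toLp, hm2.coeFn_toLp⟩
  exact ⟨⟨_, hmem⟩, hm1.coeFn_toLp, hm2.coeFn_toLp⟩

/-- Compactly supported `C¹` functions belong to `H¹₀`. -/
lemma exists_of_contDiff_one [IsFiniteMeasure (volume.restrict Ω)] (hΩ : IsOpen Ω) {ψ : RN N → ℝ}
    (h1 : ContDiff ℝ 1 ψ) (h2 : HasCompactSupport ψ) (h3 : tsupport ψ ⊆ Ω) :
    ∃ W : H10 Ω, toFun W =ᵐ[volume.restrict Ω] ψ ∧ grad W =ᵐ[volume.restrict Ω] gradient ψ := by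
  have hpos : ∀ n : ℕ, 0 < 1 / ((n : ℝ) + 1) := fun n => Nat.one_div_pos_of_nat
  have hle1 : ∀ n : ℕ, 1 / ((n : ℝ) + 1) ≤ 1 := fun n => by
    rw [div_le_one (by positivity)]
    have : (0 : ℝ) ≤ n := n.cast_nonneg
    linarith
  choose η hη1 hη2 hη3 hη4 hη5 using fun n => exists_contDiff_approx h1 h2 hΩ h3 (hpos n)
  choose W hW1 hW2 using fun n => exists_of_test (hη1 n) (hη2 n) (hη3 n)
  have hgle : ∀ n x, ‖gradient (η n) x - gradient ψ x‖ ≤ 1 / ((n : ℝ) + 1) := by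
    intro n x
    rw [gradient, gradient, ← map_sub, LinearIsometryEquiv.norm_map]
    exact hη5 n x
  have hm1 : MemLp ψ 2 (volume.restrict Ω) := h1.continuous.memLp_of_hasCompactSupport h2
  have hm2 : MemLp (gradient ψ) 2 (volume.restrict Ω) :=
    (continuous_gradient h1).memLp_of_hasCompactSupport (hasCompactSupport_gradient h2)
  refine exists_of_tendsto W hm1 hm2 ?_ ?_
  · refine tendsto_eLpNorm_two_of_dominated (b := fun _ => 1) (fun n => (memLp_toFun _).1) hm1.1
      (memLp_const 1) (fun n => ?_) ?_
    · filter_upwards [hW1 n] with x hx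
      rw [hx]
      exact (hη4 n x).trans (hle1 n)
    · filter_upwards [ae_all_iff.2 hW1] with x hx
      rw [tendsto_iff_norm_sub_tendsto_zero]
      refine squeeze_zero (fun n => norm_nonneg _) (fun n => ?_)
        tendsto_one_div_add_atTop_nhds_zero_nat
      rw [hx n]
      exact hη4 n x
  · refine tendsto_eLpNorm_two_of_dominated (b := fun _ => 1) (fun n => (memLp_grad _).1) hm2.1
      (memLp_const 1) (fun n => ?_) ?_
    · filter_upwards [hW2 n] with x hx
      rw [hx]
      exact (hgle n x).trans (hle1 n)
    · filter_upwards [ae_all_iff.2 hW2] with x hx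
      rw [tendsto_iff_norm_sub_tendsto_zero]
      refine squeeze_zero (fun n => norm_nonneg _) (fun n => ?_)
        tendsto_one_div_add_atTop_nhds_zero_nat
      rw [hx n]
      exact hgle n x

end H10

/-! ### Green's identity with compact support. -/

section Green

lemma integrableOn_of_compact_support {X F : Type*} [TopologicalSpace X] [T2Space X]
    [MeasurableSpace X] [OpensMeasurableSpace X] [NormedAddCommGroup F]
    {μ : Measure X} [IsFiniteMeasureOnCompacts μ] {h : X → F} {D K : Set X} (hD : IsOpen D)
    (hK : IsCompact K) (hKD : K ⊆ D) (hh : ContinuousOn h D) (h0 : ∀ x ∈ D \ K, h x = 0) :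
    IntegrableOn h D μ :=
  ((hh.mono hKD).integrableOn_compact hK).of_forall_sdiff_eq_zero hD.measurableSet h0

variable {N : ℕ}

lemma integral_fderiv_eq_zero {h : RN N → ℝ} (hh : ContDiff ℝ 1 h) (hc : HasCompactSupport h)
    (v : RN N) : ∫ x, fderiv ℝ h x v = 0 := by
  have h1 : Integrable (fun x => fderiv ℝ h x v) :=
    ((hh.continuous_fderiv one_ne_zero).clm_apply continuous_const).integrable_of_hasCompactSupport
      ((hc.fderiv ℝ).comp_left (g := fun L : RN N →L[ℝ] ℝ => L v) (by simp))
  have h2 := integral_mul_fderiv_eq_neg_fderiv_mul_of_integrable (μ := (volume : Measure (RN N)))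
    (f := fun _ => (1 : ℝ)) (g := h) (v := v) (by simp) (by simpa using h1)
    (by simpa using hh.continuous.integrable_of_hasCompactSupport hc)
    (fun x _ => differentiableAt_const 1)
    (fun x _ => (hh.differentiable one_ne_zero) x)
  simpa using h2

lemma continuousOn_gradient {a : RN N → ℝ} {D : Set (RN N)} (hD : IsOpen D)
    (ha : ContDiffOn ℝ 1 a D) : ContinuousOn (gradient a) D :=
  (InnerProductSpace.toDual ℝ (RN N)).symm.continuous.comp_continuousOn
    (ha.continuousOn_fderiv_of_isOpen hD le_rfl)

lemma notMem_tsupport_gradient {a : RN N → ℝ} {x : RN N} (hx : x ∉ tsupport a) :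
    gradient a x = 0 := by
  rw [gradient, image_eq_zero_of_notMem_tsupport fun h => hx (tsupport_fderiv_subset ℝ h), map_zero]

lemma laplacian_eq_zero_of_notMem_tsupport {b : RN N → ℝ} {x : RN N} (hx : x ∉ tsupport b) :
    Laplacian.laplacian b x = 0 := by
  rw [(InnerProductSpace.laplacian_congr_nhds (notMem_tsupport_iff_eventuallyEq.1 hx)).eq_of_nhds]
  have := congrFun (InnerProductSpace.laplacian_const (E := RN N) (c := (0 : ℝ))) x
  exact this

/-- Green's first identity without boundary terms. -/
theorem green_identity {a b : RN N → ℝ} {D K : Set (RN N)} (hD : IsOpen D) (hK : IsCompact K)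
    (hKD : K ⊆ D) (ha : ContDiffOn ℝ 1 a D) (hb : ContDiffOn ℝ 2 b D)
    (hsupp : tsupport a ⊆ K ∨ tsupport b ⊆ K) :
    IntegrableOn (fun x => inner ℝ (gradient a x) (gradient b x)) D ∧
    IntegrableOn (fun x => a x * Laplacian.laplacian b x) D ∧
    ∫ x in D, inner ℝ (gradient a x) (gradient b x) =
      -∫ x in D, a x * Laplacian.laplacian b x := by
  have hb1 : ContDiffOn ℝ 1 b D := hb.of_le (by norm_num)
  have hi1 : IntegrableOn (fun x => inner ℝ (gradient a x) (gradient b x)) D := by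
    refine integrableOn_of_compact_support hD hK hKD
      ((continuousOn_gradient hD ha).inner (continuousOn_gradient hD hb1)) fun x hx => ?_
    rcases hsupp with h | h
    · rw [notMem_tsupport_gradient fun h' => hx.2 (h h'), inner_zero_left]
    · rw [notMem_tsupport_gradient (a := b) fun h' => hx.2 (h h'), inner_zero_right]
  have hi2 : IntegrableOn (fun x => a x * Laplacian.laplacian b x) D := by
    refine integrableOn_of_compact_support hD hK hKD
      (ha.continuousOn.mul (continuousOn_laplacian hD hb)) fun x hx => ?_
    rcases hsupp with h | h
    · rw [image_eq_zero_of_notMem_tsupport fun h' => hx.2 (h h'), zero_mul]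
    · rw [laplacian_eq_zero_of_notMem_tsupport (b := b) fun h' => hx.2 (h h'), mul_zero]
  refine ⟨hi1, hi2, ?_⟩
  set e := EuclideanSpace.basisFun (Fin N) ℝ
  -- These are the components of the field a∇b. Its divergence is ∇a·∇b + aΔb, and the integral of
  -- the divergence vanishes by compact support.
  set X : Fin N → RN N → ℝ := fun i x => a x * fderiv ℝ b x (e i) with hX
  have hbi : ∀ i, ContDiffOn ℝ 1 (fun x => fderiv ℝ b x (e i)) D := fun i =>
    (hb.fderiv_of_isOpen hD (m := 1) (by norm_num)).clm_apply contDiffOn_const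
  have hXsupp : ∀ i, tsupport (X i) ⊆ K := by
    intro i
    rcases hsupp with h | h
    · exact tsupport_mul_subset_left.trans h
    · refine tsupport_mul_subset_right.trans (subset_trans ?_ h)
      refine subset_trans (closure_mono fun x hx => ?_) (tsupport_fderiv_subset ℝ)
      rw [Function.mem_support] at hx ⊢
      intro h0
      exact hx (by rw [h0]; rfl)
  have hXc : ∀ i, HasCompactSupport (X i) := fun i =>
    hK.of_isClosed_subset (isClosed_tsupport _) (hXsupp i)
  have hX1 : ∀ i, ContDiff ℝ 1 (X i) := fun i =>
    contDiff_of_contDiffAt_tsupport fun x hx =>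
      (ha.mul (hbi i)).contDiffAt (hD.mem_nhds (hKD (hXsupp i hx)))
  have hXD : ∀ i, ∫ x in D, fderiv ℝ (X i) x (e i) = 0 := by
    intro i
    rw [setIntegral_eq_integral_of_forall_compl_eq_zero, integral_fderiv_eq_zero (hX1 i) (hXc i)]
    intro x hx
    rw [image_eq_zero_of_notMem_tsupport
      fun h => hx (hKD (hXsupp i (tsupport_fderiv_subset ℝ h)))]
    rfl
  have hXint : ∀ i, IntegrableOn (fun x => fderiv ℝ (X i) x (e i)) D := fun i =>
    (((hX1 i).continuous_fderiv one_ne_zero).clm_apply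
      continuous_const).integrable_of_hasCompactSupport
      (((hXc i).fderiv ℝ).comp_left (g := fun L : RN N →L[ℝ] ℝ => L (e i)) (by simp))
      |>.integrableOn
  have hsum : ∀ x ∈ D, inner ℝ (gradient a x) (gradient b x) + a x * Laplacian.laplacian b x =
      ∑ i, fderiv ℝ (X i) x (e i) := by
    intro x hx
    have hxD := hD.mem_nhds hx
    have hd1 : DifferentiableAt ℝ a x := (ha.contDiffAt hxD).differentiableAt one_ne_zero
    rw [laplacian_eq_sum_fderiv e (hb.contDiffAt hxD), Finset.mul_sum,
      ← e.sum_inner_mul_inner (gradient a x) (gradient b x), ← Finset.sum_add_distrib]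
    refine Finset.sum_congr rfl fun i _ => ?_
    have hd2 : DifferentiableAt ℝ (fun x => fderiv ℝ b x (e i)) x :=
      ((hbi i).contDiffAt hxD).differentiableAt one_ne_zero
    have h1 : inner ℝ (gradient a x) (e i) = fderiv ℝ a x (e i) := by
      rw [inner_gradient_left]
    have h2 : inner ℝ (e i) (gradient b x) = fderiv ℝ b x (e i) := by
      rw [inner_gradient_right]; simp
    rw [h1, h2, fderiv_fun_mul hd1 hd2]
    simp
    ring
  have htot : ∫ x in D, (inner ℝ (gradient a x) (gradient b x) +
      a x * Laplacian.laplacian b x) = 0 := by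
    rw [setIntegral_congr_fun hD.measurableSet hsum, integral_finsetSum _ fun i _ => hXint i]
    exact Finset.sum_eq_zero fun i _ => hXD i
  rw [integral_add hi1 hi2] at htot
  linarith

end Green

/-! ### The truncation (t - ε)₊²/t and its limit as ε → 0. -/

section Truncation

/-- A `C¹` truncation of `t ↦ t` on the positive half-line, vanishing on `(0, ε]`. -/
def trunc (ε t : ℝ) : ℝ := max (t - ε) 0 ^ 2 / t

/-- The derivative of `trunc ε` on the positive half-line. -/
def truncDeriv (ε t : ℝ) : ℝ := max (t - ε) 0 * (2 * t - max (t - ε) 0) / t ^ 2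

lemma hasDerivAt_max_sq (t : ℝ) : HasDerivAt (fun t : ℝ => max t 0 ^ 2) (2 * max t 0) t := by
  rcases lt_trichotomy t 0 with h | rfl | h
  · rw [max_eq_right h.le, mul_zero]
    refine (hasDerivAt_const t (0 : ℝ)).congr_of_eventuallyEq ?_
    filter_upwards [Iio_mem_nhds h] with s hs
    simp [max_eq_right (le_of_lt (mem_Iio.1 hs))]
  · rw [max_self, mul_zero, hasDerivAt_iff_isLittleO]
    simp only [max_self, sub_zero, smul_zero, ne_eq, OfNat.ofNat_ne_zero, not_false_eq_true,
      zero_pow]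
    have h1 : (fun s : ℝ => s ^ 2) =o[𝓝 0] fun s => s := by
      simpa using Asymptotics.isLittleO_pow_id (𝕜 := ℝ) (n := 2) one_lt_two
    refine Asymptotics.IsBigO.trans_isLittleO (Asymptotics.IsBigO.of_bound 1 ?_) h1
    refine Eventually.of_forall fun s => ?_
    rw [one_mul, norm_pow, norm_pow]
    refine pow_le_pow_left₀ (norm_nonneg _) ?_ 2
    rw [Real.norm_eq_abs, Real.norm_eq_abs, abs_of_nonneg (le_max_right _ _)]
    exact max_le (le_abs_self s) (abs_nonneg s)
  · rw [max_eq_left h.le]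
    have h1 := hasDerivAt_pow 2 t
    norm_num at h1
    refine h1.congr_of_eventuallyEq ?_
    filter_upwards [Ioi_mem_nhds h] with s hs
    rw [max_eq_left (le_of_lt hs)]

/-- Squaring removes the corner of the positive part. A piecewise linear truncation would not give
C¹ functions. -/
lemma contDiff_max_sq : ContDiff ℝ 1 (fun t : ℝ => max t 0 ^ 2) := by
  rw [contDiff_one_iff_deriv]
  refine ⟨fun t => (hasDerivAt_max_sq t).differentiableAt, ?_⟩
  rw [funext fun t => (hasDerivAt_max_sq t).deriv]
  fun_prop

lemma contDiffAt_trunc (ε : ℝ) {t : ℝ} (ht : t ≠ 0) : ContDiffAt ℝ 1 (trunc ε) t :=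
  (contDiff_max_sq.comp (contDiff_id.sub contDiff_const)).contDiffAt.div contDiffAt_id ht

lemma hasDerivAt_trunc (ε : ℝ) {t : ℝ} (ht : t ≠ 0) : HasDerivAt (trunc ε) (truncDeriv ε t) t := by
  have h1 := (hasDerivAt_max_sq (t - ε)).comp t ((hasDerivAt_id t).sub_const ε)
  have h2 := h1.div (hasDerivAt_id t) ht
  refine HasDerivAt.congr_deriv (f := trunc ε) h2 ?_
  simp only [truncDeriv, Function.comp_apply, id_eq]
  ring

lemma trunc_eq_zero {ε t : ℝ} (h : t ≤ ε) : trunc ε t = 0 := by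
  simp [trunc, h]

lemma trunc_mem_Icc {ε t : ℝ} (hε : 0 < ε) (ht : 0 < t) : trunc ε t ∈ Icc 0 t := by
  have h1 : 0 ≤ max (t - ε) 0 := le_max_right _ _
  have h2 : max (t - ε) 0 ≤ t := max_le (by linarith) ht.le
  refine ⟨by unfold trunc; positivity, ?_⟩
  rw [trunc, div_le_iff₀ ht]
  nlinarith

lemma truncDeriv_mem_Icc {ε t : ℝ} (hε : 0 < ε) (ht : 0 < t) : truncDeriv ε t ∈ Icc (0 : ℝ) 1 := by
  have h1 : 0 ≤ max (t - ε) 0 := le_max_right _ _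
  have h2 : max (t - ε) 0 ≤ t := max_le (by linarith) ht.le
  refine ⟨div_nonneg (mul_nonneg h1 (by linarith)) (by positivity), ?_⟩
  rw [truncDeriv, div_le_one (by positivity)]
  nlinarith [sq_nonneg (t - max (t - ε) 0)]

lemma tendsto_max_sub {ε : ℕ → ℝ} (hε : Tendsto ε atTop (𝓝 0)) {t : ℝ} (ht : 0 < t) :
    Tendsto (fun n => max (t - ε n) 0) atTop (𝓝 t) := by
  have h : Tendsto (fun n => max (t - ε n) 0) atTop (𝓝 (max (t - 0) 0)) :=
    (tendsto_const_nhds.sub hε).max tendsto_const_nhds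
  rwa [sub_zero, max_eq_left ht.le] at h

lemma tendsto_trunc {ε : ℕ → ℝ} (hε : Tendsto ε atTop (𝓝 0)) {t : ℝ} (ht : 0 < t) :
    Tendsto (fun n => trunc (ε n) t) atTop (𝓝 t) := by
  have h := ((tendsto_max_sub hε ht).pow 2).div_const t
  rwa [pow_two, mul_div_cancel_right₀ _ ht.ne'] at h

lemma tendsto_truncDeriv {ε : ℕ → ℝ} (hε : Tendsto ε atTop (𝓝 0)) {t : ℝ} (ht : 0 < t) :
    Tendsto (fun n => truncDeriv (ε n) t) atTop (𝓝 1) := by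
  have h1 := tendsto_max_sub hε ht
  have h := (h1.mul (tendsto_const_nhds (x := 2 * t) |>.sub h1)).div_const (t ^ 2)
  have h2 : t * (2 * t - t) / t ^ 2 = 1 := by field_simp; ring
  rwa [h2] at h

end Truncation

/-! ### Positive functions with compact superlevel sets belong to H¹₀. -/

section Positive

variable {N : ℕ} {D : Set (RN N)} {g : RN N → ℝ}

lemma support_indicator_trunc_subset (ε : ℝ) :
    Function.support (D.indicator fun x => trunc ε (g x)) ⊆ D ∩ {x | ε ≤ g x} := by
  intro x hx
  have hxD : x ∈ D := by
    by_contra h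
    exact hx (indicator_of_notMem h _)
  refine ⟨hxD, ?_⟩
  by_contra h
  rw [mem_ofPred_eq, not_le] at h
  rw [Function.mem_support, indicator_of_mem hxD] at hx
  exact hx (trunc_eq_zero h.le)

/-- Compactness makes the superlevel set closed in the whole space, so truncation keeps the support
away from ∂D without any regularity of ∂D. -/
lemma tsupport_indicator_trunc_subset {ε : ℝ} (hcomp : IsCompact (D ∩ {x | ε ≤ g x})) :
    tsupport (D.indicator fun x => trunc ε (g x)) ⊆ D ∩ {x | ε ≤ g x} :=
  closure_minimal (support_indicator_trunc_subset ε) hcomp.isClosed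

lemma contDiff_indicator_trunc (hD : IsOpen D) (hg : ContDiffOn ℝ 2 g D) (hpos : ∀ x ∈ D, 0 < g x)
    {ε : ℝ} (hcomp : IsCompact (D ∩ {x | ε ≤ g x})) :
    ContDiff ℝ 1 (D.indicator fun x => trunc ε (g x)) := by
  refine contDiff_of_contDiffAt_tsupport fun x hx => ?_
  have hxD : x ∈ D := (tsupport_indicator_trunc_subset hcomp hx).1
  have h1 : ContDiffAt ℝ 1 (fun x => trunc ε (g x)) x :=
    (contDiffAt_trunc ε (hpos x hxD).ne').comp x
      ((hg.contDiffAt (hD.mem_nhds hxD)).of_le (by norm_num))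
  refine h1.congr_of_eventuallyEq ?_
  filter_upwards [hD.mem_nhds hxD] with y hy
  rw [indicator_of_mem hy]

lemma gradient_indicator_trunc (hD : IsOpen D) (hg : ContDiffOn ℝ 2 g D)
    (hpos : ∀ x ∈ D, 0 < g x) (ε : ℝ) {x : RN N} (hx : x ∈ D) :
    gradient (D.indicator fun x => trunc ε (g x)) x = truncDeriv ε (g x) • gradient g x := by
  have h1 : (D.indicator fun x => trunc ε (g x)) =ᶠ[𝓝 x] fun x => trunc ε (g x) := by
    filter_upwards [hD.mem_nhds hx] with y hy
    rw [indicator_of_mem hy]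
  have h2 : HasFDerivAt g (fderiv ℝ g x) x :=
    ((hg.contDiffAt (hD.mem_nhds hx)).differentiableAt (by norm_num)).hasFDerivAt
  have h3 := (hasDerivAt_trunc ε (hpos x hx).ne').comp_hasFDerivAt x h2
  rw [gradient, h1.fderiv_eq, HasFDerivAt.fderiv (f := fun x => trunc ε (g x)) h3, map_smul]
  rfl

/-- A positive `C²` function on an open set `D ⊆ Ω` with bounded Laplacian, tending to zero at the
boundary of `D`, extends by zero to an element of `H¹₀(Ω)`. -/
theorem H10.exists_of_pos {Ω : Set (RN N)} (hΩ : IsOpen Ω) [IsFiniteMeasure (volume.restrict Ω)]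
    (hD : IsOpen D) (hDΩ : D ⊆ Ω) (hg : ContDiffOn ℝ 2 g D) (hpos : ∀ x ∈ D, 0 < g x)
    (hcomp : ∀ ε > 0, IsCompact (D ∩ {x | ε ≤ g x})) {M B : ℝ}
    (hM : ∀ x ∈ D, g x ≤ M) (hB : ∀ x ∈ D, |Laplacian.laplacian g x| ≤ B) :
    ∃ W : H10 Ω, H10.toFun W =ᵐ[volume.restrict Ω] D.indicator g ∧
      H10.grad W =ᵐ[volume.restrict Ω] D.indicator (gradient g) ∧
      ∫ x in D, ‖gradient g x‖ ^ 2 = -∫ x in D, g x * Laplacian.laplacian g x := by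
  have hDm := hD.measurableSet
  have hDfin : IsFiniteMeasure (volume.restrict D) := by
    constructor
    rw [Measure.restrict_apply_univ]
    refine (measure_mono hDΩ).trans_lt ?_
    rw [← Measure.restrict_apply_univ]
    exact measure_lt_top _ _
  have hcongr : ∀ {F : Type} [NormedAddCommGroup F] (h k : RN N → F),
      (∀ x ∈ D, h x = k x) → h =ᵐ[volume.restrict D] k := fun h k hk =>
    (ae_restrict_mem hDm).mono hk
  set ε : ℕ → ℝ := fun n => 1 / ((n : ℝ) + 1) with hεdef
  have hε : ∀ n, 0 < ε n := fun n => Nat.one_div_pos_of_nat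
  have hε0 : Tendsto ε atTop (𝓝 0) := tendsto_one_div_add_atTop_nhds_zero_nat
  set ψ : ℕ → RN N → ℝ := fun n => D.indicator fun x => trunc (ε n) (g x) with hψ
  have hψ1 : ∀ n, ContDiff ℝ 1 (ψ n) := fun n =>
    contDiff_indicator_trunc hD hg hpos (hcomp _ (hε n))
  have hψs : ∀ n, tsupport (ψ n) ⊆ D ∩ {x | ε n ≤ g x} := fun n =>
    tsupport_indicator_trunc_subset (hcomp _ (hε n))
  have hψc : ∀ n, HasCompactSupport (ψ n) := fun n =>
    (hcomp _ (hε n)).of_isClosed_subset (isClosed_tsupport _) (hψs n)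
  have hψg : ∀ n, ∀ x ∈ D, gradient (ψ n) x = truncDeriv (ε n) (g x) • gradient g x :=
    fun n x hx => gradient_indicator_trunc hD hg hpos (ε n) hx
  have hψg0 : ∀ n, ∀ x ∉ D, gradient (ψ n) x = 0 := fun n x hx =>
    notMem_tsupport_gradient fun h => hx (hψs n h).1
  -- Testing Δg with the truncated `g`; its support is compact, so no boundary term appears.
  have hgreen : ∀ n, Integrable (fun x => truncDeriv (ε n) (g x) * ‖gradient g x‖ ^ 2)
      (volume.restrict D) ∧ ∫ x in D, truncDeriv (ε n) (g x) * ‖gradient g x‖ ^ 2 =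
        -∫ x in D, trunc (ε n) (g x) * Laplacian.laplacian g x := by
    intro n
    obtain ⟨h1, h2, h3⟩ := green_identity hD (hcomp _ (hε n)) inter_subset_left
      (hψ1 n).contDiffOn hg (Or.inl (hψs n))
    have h4 : ∀ x ∈ D, inner ℝ (gradient (ψ n) x) (gradient g x) =
        truncDeriv (ε n) (g x) * ‖gradient g x‖ ^ 2 := fun x hx => by
      rw [hψg n x hx, real_inner_smul_left, real_inner_self_eq_norm_sq]
    have h5 : ∀ x ∈ D, ψ n x * Laplacian.laplacian g x =
        trunc (ε n) (g x) * Laplacian.laplacian g x := fun x hx => by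
      simp only [hψ, indicator_of_mem hx]
    rw [setIntegral_congr_fun hDm h4, setIntegral_congr_fun hDm h5] at h3
    exact ⟨h1.congr (hcongr _ _ h4), h3⟩
  have hgc : ContinuousOn (gradient g) D := continuousOn_gradient hD (hg.of_le (by norm_num))
  have hgm : AEStronglyMeasurable (gradient g) (volume.restrict D) :=
    hgc.aestronglyMeasurable hDm
  have hlapm : AEStronglyMeasurable (Laplacian.laplacian g) (volume.restrict D) :=
    (continuousOn_laplacian hD hg).aestronglyMeasurable hDm
  have htm : ∀ n, AEStronglyMeasurable (fun x => trunc (ε n) (g x)) (volume.restrict D) :=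
    fun n => ((hψ1 n).continuous.aestronglyMeasurable.restrict (s := D)).congr
      (hcongr _ _ fun x hx => indicator_of_mem hx _)
  have hbound : ∀ n, ∀ x ∈ D, ‖trunc (ε n) (g x) * Laplacian.laplacian g x‖ ≤ M * B := by
    intro n x hx
    obtain ⟨h1, h2⟩ := trunc_mem_Icc (hε n) (hpos x hx)
    rw [norm_mul, Real.norm_of_nonneg h1]
    exact mul_le_mul (h2.trans (hM x hx)) (hB x hx) (norm_nonneg _)
      ((hpos x hx).le.trans (hM x hx))
  have hlimR : Tendsto (fun n => ∫ x in D, trunc (ε n) (g x) * Laplacian.laplacian g x) atTop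
      (𝓝 (∫ x in D, g x * Laplacian.laplacian g x)) := by
    refine tendsto_integral_of_dominated_convergence (fun _ => M * B)
      (fun n => (htm n).mul hlapm) (integrable_const _)
      (fun n => (ae_restrict_mem hDm).mono (hbound n)) ?_
    filter_upwards [ae_restrict_mem hDm] with x hx
    exact (tendsto_trunc hε0 (hpos x hx)).mul_const _
  -- Square integrability of ∇g is not known beforehand. It follows from Fatou's lemma, because the
  -- truncated Dirichlet integrals are bounded by MB times the measure of `D`.
  have hsq : Integrable (fun x => ‖gradient g x‖ ^ 2) (volume.restrict D) := by
    refine ⟨hgm.norm.pow 2, ?_⟩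
    have h1 : ∫⁻ x in D, ‖‖gradient g x‖ ^ 2‖ₑ ≤ liminf (fun n =>
        ∫⁻ x in D, ‖truncDeriv (ε n) (g x) * ‖gradient g x‖ ^ 2‖ₑ) atTop := by
      refine le_trans (le_of_eq (lintegral_congr_ae ?_))
        (lintegral_liminf_le' fun n => (hgreen n).1.1.enorm)
      filter_upwards [ae_restrict_mem hDm] with x hx
      have h2 := ((tendsto_truncDeriv hε0 (hpos x hx)).mul_const (‖gradient g x‖ ^ 2)).enorm
      rw [one_mul] at h2
      exact h2.liminf_eq.symm
    refine h1.trans_lt (lt_of_le_of_lt (b := ENNReal.ofReal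
      (M * B * (volume.restrict D).real univ)) ?_ ENNReal.ofReal_lt_top)
    refine liminf_le_of_le (by isBoundedDefault) fun b hb => ?_
    obtain ⟨n, hn⟩ := hb.exists
    refine hn.trans ?_
    have h3 : ∀ x ∈ D, ‖truncDeriv (ε n) (g x) * ‖gradient g x‖ ^ 2‖ₑ =
        ENNReal.ofReal (truncDeriv (ε n) (g x) * ‖gradient g x‖ ^ 2) := fun x hx => by
      rw [Real.enorm_of_nonneg]
      exact mul_nonneg (truncDeriv_mem_Icc (hε n) (hpos x hx)).1 (by positivity)
    rw [setLIntegral_congr_fun hDm h3, ← ofReal_integral_eq_lintegral_ofReal (hgreen n).1, (hgreen n).2]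
    · refine ENNReal.ofReal_le_ofReal ((neg_le_abs _).trans ?_)
      exact norm_integral_le_of_norm_le_const ((ae_restrict_mem hDm).mono (hbound n))
    · filter_upwards [ae_restrict_mem hDm] with x hx
      exact mul_nonneg (truncDeriv_mem_Icc (hε n) (hpos x hx)).1 (by positivity)
  have hid : ∫ x in D, ‖gradient g x‖ ^ 2 = -∫ x in D, g x * Laplacian.laplacian g x := by
    have h1 : Tendsto (fun n => ∫ x in D, truncDeriv (ε n) (g x) * ‖gradient g x‖ ^ 2) atTop
        (𝓝 (∫ x in D, ‖gradient g x‖ ^ 2)) := by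
      refine tendsto_integral_of_dominated_convergence _ (fun n => (hgreen n).1.1) hsq
        (fun n => ?_) ?_
      · filter_upwards [ae_restrict_mem hDm] with x hx
        obtain ⟨h2, h3⟩ := truncDeriv_mem_Icc (hε n) (hpos x hx)
        rw [Real.norm_of_nonneg (by positivity)]
        exact mul_le_of_le_one_left (by positivity) h3
      · filter_upwards [ae_restrict_mem hDm] with x hx
        simpa using (tendsto_truncDeriv hε0 (hpos x hx)).mul_const (‖gradient g x‖ ^ 2)
    rw [funext fun n => (hgreen n).2] at h1
    exact tendsto_nhds_unique h1 hlimR.neg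
  have hrestr : (volume.restrict Ω).restrict D = volume.restrict D := by
    rw [Measure.restrict_restrict hDm, inter_eq_left.2 hDΩ]
  have hmg : MemLp (D.indicator g) 2 (volume.restrict Ω) := by
    rw [memLp_indicator_iff_restrict hDm, hrestr]
    refine MemLp.of_bound (hg.continuousOn.aestronglyMeasurable hDm) M ?_
    filter_upwards [ae_restrict_mem hDm] with x hx
    rw [Real.norm_of_nonneg (hpos x hx).le]
    exact hM x hx
  have hmG : MemLp (D.indicator (gradient g)) 2 (volume.restrict Ω) := by
    rw [memLp_indicator_iff_restrict hDm, hrestr, memLp_two_iff_integrable_sq_norm hgm]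
    exact hsq
  choose w hw1 hw2 using fun n => H10.exists_of_contDiff_one hΩ (hψ1 n) (hψc n)
    (((hψs n).trans inter_subset_left).trans hDΩ)
  obtain ⟨W, hW1, hW2⟩ := H10.exists_of_tendsto w hmg hmG
    (by
      refine tendsto_eLpNorm_two_of_dominated (fun n => (H10.memLp_toFun _).1) hmg.1 hmg.norm
        (fun n => ?_) ?_
      · filter_upwards [hw1 n] with x hx
        rw [hx]
        by_cases hxD : x ∈ D
        · obtain ⟨h1, h2⟩ := trunc_mem_Icc (hε n) (hpos x hxD)
          simp only [hψ, indicator_of_mem hxD, Real.norm_eq_abs]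
          rw [abs_of_pos (hpos x hxD), abs_le]
          constructor <;> linarith
        · simp [hψ, indicator_of_notMem hxD]
      · filter_upwards [ae_all_iff.2 hw1] with x hx
        simp only [hx]
        by_cases hxD : x ∈ D
        · simp only [hψ, indicator_of_mem hxD]
          exact tendsto_trunc hε0 (hpos x hxD)
        · simp [hψ, indicator_of_notMem hxD])
    (by
      refine tendsto_eLpNorm_two_of_dominated (fun n => (H10.memLp_grad _).1) hmG.1 hmG.norm
        (fun n => ?_) ?_
      · filter_upwards [hw2 n] with x hx
        rw [hx]
        by_cases hxD : x ∈ D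
        · obtain ⟨h1, h2⟩ := truncDeriv_mem_Icc (hε n) (hpos x hxD)
          rw [hψg n x hxD, indicator_of_mem hxD, show ∀ (c : ℝ) (v : RN N), c • v - v = (c - 1) • v from
            fun c v => by module, norm_smul]
          refine mul_le_of_le_one_left (norm_nonneg _) ?_
          rw [Real.norm_eq_abs, abs_le]
          constructor <;> linarith
        · simp [hψg0 n x hxD, indicator_of_notMem hxD]
      · filter_upwards [ae_all_iff.2 hw2] with x hx
        simp only [hx]
        by_cases hxD : x ∈ D
        · simp only [hψg _ x hxD, indicator_of_mem hxD]
          simpa using (tendsto_truncDeriv hε0 (hpos x hxD)).smul_const (gradient g x)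
        · simp [hψg0 _ x hxD, indicator_of_notMem hxD])
  exact ⟨W, hW1, hW2, hid⟩

end Positive

/-! ### Positive parts and classical solutions in H¹₀, and the weak equation. -/

section WeakEquation

variable {N : ℕ} {Ω : Set (RN N)}

/-- The growth and Lipschitz bounds on f hold only almost everywhere, whereas the maximum principle
needs pointwise bounds on the Laplacians. Continuity bridges the gap, since a violation would occupy
a nonempty open set. -/
lemma forall_le_of_ae_le {X : Type*} [TopologicalSpace X] [MeasurableSpace X]
    [OpensMeasurableSpace X] {μ : Measure X} [μ.IsOpenPosMeasure] {U : Set X} (hU : IsOpen U)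
    {g h : X → ℝ} (hg : ContinuousOn g U) (hh : ContinuousOn h U)
    (hle : ∀ᵐ x ∂(μ.restrict U), g x ≤ h x) : ∀ x ∈ U, g x ≤ h x := by
  by_contra! hcon
  obtain ⟨x, hx, hlt⟩ := hcon
  have hopen : IsOpen (U ∩ (fun x => g x - h x) ⁻¹' Ioi 0) :=
    (hg.sub hh).isOpen_inter_preimage hU isOpen_Ioi
  refine (hopen.measure_pos μ ⟨x, hx, sub_pos.2 hlt⟩).ne' ?_
  rw [ae_restrict_iff' hU.measurableSet] at hle
  refine measure_mono_null (fun z hz => ?_) hle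
  simp only [mem_compl_iff, mem_ofPred_eq, not_forall, not_le]
  exact ⟨hz.1, sub_pos.1 hz.2⟩

lemma isCompact_superlevel {S : Set (RN N)} (hS : Bornology.IsBounded S) {g : RN N → ℝ}
    (hg : ContinuousOn g (closure S)) (h0 : ∀ x ∈ closure S \ S, g x = 0) {ε : ℝ} (hε : 0 < ε) :
    IsCompact ((S ∩ {x | 0 < g x}) ∩ {x | ε ≤ g x}) := by
  have h : (S ∩ {x | 0 < g x}) ∩ {x | ε ≤ g x} = closure S ∩ g ⁻¹' Ici ε := by
    ext x
    constructor
    · rintro ⟨⟨h1, -⟩, h2⟩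
      exact ⟨subset_closure h1, h2⟩
    · rintro ⟨h1, h2⟩
      have h2 : ε ≤ g x := h2
      have h3 : x ∈ S := by
        by_contra h4
        rw [h0 x ⟨h1, h4⟩] at h2
        linarith
      exact ⟨⟨h3, hε.trans_le h2⟩, h2⟩
  rw [h]
  exact hS.isCompact_closure.of_isClosed_subset
    (hg.preimage_isClosed_of_isClosed isClosed_closure isClosed_Ici) inter_subset_left

/-- The positive part on `S ⊆ Ω` of a `C²` function vanishing on `∂S` belongs to `H¹₀(Ω)`. -/
theorem H10.exists_posPart (hΩ : IsOpen Ω) (hΩb : Bornology.IsBounded Ω) {S : Set (RN N)}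
    (hS : IsOpen S) (hSΩ : S ⊆ Ω) {g : RN N → ℝ} (hg : ContDiffOn ℝ 2 g Ω)
    (hgc : ContinuousOn g (closure Ω)) (h0 : ∀ x ∈ closure S \ S, g x = 0) {B : ℝ}
    (hB : ∀ x ∈ Ω, |Laplacian.laplacian g x| ≤ B) :
    ∃ W : H10 Ω, H10.toFun W =ᵐ[volume.restrict Ω] (S ∩ {x | 0 < g x}).indicator g ∧
      H10.grad W =ᵐ[volume.restrict Ω] (S ∩ {x | 0 < g x}).indicator (gradient g) ∧
      ∫ x in S ∩ {x | 0 < g x}, ‖gradient g x‖ ^ 2 =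
        -∫ x in S ∩ {x | 0 < g x}, g x * Laplacian.laplacian g x := by
  have : IsFiniteMeasure (volume.restrict Ω) :=
    ⟨by rw [Measure.restrict_apply_univ]; exact hΩb.measure_lt_top⟩
  obtain ⟨M, hM⟩ := (hΩb.isCompact_closure).exists_bound_of_continuousOn hgc
  have hsub : S ∩ {x | 0 < g x} ⊆ Ω := inter_subset_left.trans hSΩ
  refine H10.exists_of_pos hΩ ((hg.continuousOn.mono hSΩ).isOpen_inter_preimage hS isOpen_Ioi)
    hsub (hg.mono hsub) (fun x hx => hx.2) (fun ε hε => ?_)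
    (fun x hx => (le_abs_self _).trans (hM x (subset_closure (hsub hx))))
    (fun x hx => hB x (hsub hx))
  exact isCompact_superlevel (hΩb.subset hSΩ) (hgc.mono (closure_mono hSΩ)) h0 hε

/-- Linear identities extend from test functions to `H¹₀`. -/
lemma H10.integral_eq_zero_of_test {a : RN N → ℝ} {G : RN N → RN N}
    (ha : MemLp a 2 (volume.restrict Ω)) (hG : MemLp G 2 (volume.restrict Ω))
    (h : ∀ φ : RN N → ℝ, ContDiff ℝ ∞ φ → HasCompactSupport φ → tsupport φ ⊆ Ω →
      (∫ x in Ω, φ x * a x) + ∫ x in Ω, inner ℝ (gradient φ x) (G x) = 0) (W : H10 Ω) :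
    (∫ x in Ω, toFun W x * a x) + ∫ x in Ω, inner ℝ (grad W x) (G x) = 0 := by
  set q : L2Pair Ω := WithLp.toLp 2 (ha.toLp, hG.toLp) with hq
  have hin : ∀ (p : L2Pair Ω) (φ : RN N → ℝ) (H : RN N → RN N),
      p.fst =ᵐ[volume.restrict Ω] φ → p.snd =ᵐ[volume.restrict Ω] H →
      inner ℝ p q = (∫ x in Ω, φ x * a x) + ∫ x in Ω, inner ℝ (H x) (G x) := by
    intro p φ H h1 h2
    rw [WithLp.prod_inner_apply, L2.inner_def, L2.inner_def]
    congr 1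
    · refine integral_congr_ae ?_
      filter_upwards [h1, ha.coeFn_toLp] with x h3 h4
      rw [← h3, ← h4, hq, real_inner_eq_re_inner, mul_comm]
      rfl
    · refine integral_congr_ae ?_
      filter_upwards [h2, hG.coeFn_toLp] with x h3 h4
      rw [← h3, ← h4, hq]
      rfl
  -- The identity is orthogonality to the fixed pair `q`. It passes to the closure because an
  -- orthogonal complement is closed.
  have hle : testPairs Ω ≤ (ℝ ∙ q)ᗮ := by
    rintro p ⟨φ, h1, h2, h3, h4, h5⟩
    rw [Submodule.mem_orthogonal_singleton_iff_inner_left, hin p φ _ h4 h5]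
    exact h φ h1 h2 h3
  have hW := Submodule.topologicalClosure_minimal _ hle (Submodule.isClosed_orthogonal _) W.2
  rw [Submodule.mem_orthogonal_singleton_iff_inner_left,
    hin W (toFun W) (grad W) EventuallyEq.rfl EventuallyEq.rfl] at hW
  exact hW

lemma continuous_laplacian_of_contDiff {φ : RN N → ℝ} (hφ : ContDiff ℝ 2 φ) :
    Continuous (Laplacian.laplacian φ) := by
  rw [← continuousOn_univ]
  exact continuousOn_laplacian isOpen_univ hφ.contDiffOn

lemma hasCompactSupport_laplacian {φ : RN N → ℝ} (hc : HasCompactSupport φ) :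
    HasCompactSupport (Laplacian.laplacian φ) :=
  HasCompactSupport.intro hc fun _ hx => laplacian_eq_zero_of_notMem_tsupport hx

/-- A classical function vanishing on `∂Ω`, with bounded Laplacian, belongs to `H¹₀(Ω)` and
satisfies the weak form of Poisson's equation. -/
theorem H10.exists_classical (hΩ : IsOpen Ω) (hΩb : Bornology.IsBounded Ω) {u : RN N → ℝ}
    (hu : ContDiffOn ℝ 2 u Ω) (huc : ContinuousOn u (closure Ω))
    (h0 : ∀ x ∈ closure Ω \ Ω, u x = 0) {B : ℝ} (hB : ∀ x ∈ Ω, |Laplacian.laplacian u x| ≤ B) :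
    ∃ w₀ : H10 Ω, toFun w₀ =ᵐ[volume.restrict Ω] u ∧ ∀ W : H10 Ω,
      ∫ x in Ω, inner ℝ (grad w₀ x) (grad W x) =
        -∫ x in Ω, toFun W x * Laplacian.laplacian u x := by
  have hfin : IsFiniteMeasure (volume.restrict Ω) :=
    ⟨by rw [Measure.restrict_apply_univ]; exact hΩb.measure_lt_top⟩
  -- `u` is the difference of the positive parts of `u` and `-u`.
  obtain ⟨W₁, hW₁, -, -⟩ := exists_posPart hΩ hΩb hΩ subset_rfl hu huc h0 hB
  obtain ⟨W₂, hW₂, -, -⟩ := exists_posPart (g := -u) hΩ hΩb hΩ subset_rfl hu.neg huc.neg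
    (fun x hx => by simp [h0 x hx]) (B := B)
    (fun x hx => by rw [InnerProductSpace.laplacian_neg]; simpa using hB x hx)
  have hw : toFun (W₁ - W₂) =ᵐ[volume.restrict Ω] u := by
    filter_upwards [toFun_sub W₁ W₂, hW₁, hW₂, ae_restrict_mem hΩ.measurableSet]
      with x h1 h2 h3 hx
    rw [h1, Pi.sub_apply, h2, h3]
    rcases lt_trichotomy (u x) 0 with h | h | h
    · rw [indicator_of_notMem (fun h' => lt_asymm h h'.2), indicator_of_mem (show x ∈ Ω ∩ {x | 0 < (-u) x} from ⟨hx, neg_pos.2 h⟩)]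
      simp
    · rw [indicator_of_notMem (fun h' => h'.2.ne' h), indicator_of_notMem, h, sub_zero]
      rintro ⟨-, h'⟩
      simp [h] at h'
    · rw [indicator_of_mem (show x ∈ Ω ∩ {x | 0 < u x} from ⟨hx, h⟩), indicator_of_notMem, sub_zero]
      rintro ⟨-, h'⟩
      simp only [Pi.neg_apply, mem_ofPred_eq, Left.neg_pos_iff] at h'
      exact lt_asymm h h'
  set w₀ := W₁ - W₂
  refine ⟨w₀, hw, fun W => ?_⟩
  have hlap : MemLp (Laplacian.laplacian u) 2 (volume.restrict Ω) :=
    MemLp.of_bound ((continuousOn_laplacian hΩ hu).aestronglyMeasurable hΩ.measurableSet) B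
      ((ae_restrict_mem hΩ.measurableSet).mono hB)
  have key := integral_eq_zero_of_test hlap (memLp_grad w₀) (fun φ h1 h2 h3 => ?_) W
  · simp only [real_inner_comm (grad W _)] at key ⊢
    linarith
  · have hφ2 : ContDiff ℝ 2 φ := contDiff_infty.1 h1 2
    have hφ1 : ContDiff ℝ 1 φ := h1.of_le (by exact_mod_cast le_top)
    have g1 := (green_identity hΩ h2 h3 hφ1.contDiffOn hu (Or.inl subset_rfl)).2.2
    have g2 := (green_identity hΩ h2 h3 (hu.of_le (by norm_num)) hφ2.contDiffOn
      (Or.inr subset_rfl)).2.2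
    -- The weak gradient of `w₀` need not be identified with ∇u: both pair with ∇φ to give -∫uΔφ,
    -- for `w₀` by extending Green's identity for φ from test functions to H¹₀.
    have g3 := integral_eq_zero_of_test (Ω := Ω) (a := Laplacian.laplacian φ) (G := gradient φ)
      ((continuous_laplacian_of_contDiff hφ2).memLp_of_hasCompactSupport
        (hasCompactSupport_laplacian h2))
      ((continuous_gradient hφ1).memLp_of_hasCompactSupport (hasCompactSupport_gradient h2))
      (fun η k1 k2 k3 => by
        have hη1 : ContDiff ℝ 1 η := k1.of_le (by exact_mod_cast le_top)
        have := (green_identity hΩ k2 k3 hη1.contDiffOn hφ2.contDiffOn (Or.inl subset_rfl)).2.2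
        linarith) w₀
    have g4 : ∫ x in Ω, toFun w₀ x * Laplacian.laplacian φ x =
        ∫ x in Ω, u x * Laplacian.laplacian φ x :=
      integral_congr_ae (hw.mono fun x hx => by simp only [hx])
    have g5 : ∫ x in Ω, inner ℝ (gradient u x) (gradient φ x) =
        ∫ x in Ω, inner ℝ (gradient φ x) (gradient u x) := by
      simp only [real_inner_comm]
    have g6 : ∫ x in Ω, inner ℝ (grad w₀ x) (gradient φ x) =
        ∫ x in Ω, inner ℝ (gradient φ x) (grad w₀ x) := by
      simp only [real_inner_comm]
    linarith

end WeakEquation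

/-! ### Measurability and integrability for Carathéodory functions. -/

section Caratheodory

variable {N : ℕ} {Ω : Set (RN N)} {f : RN N → ℝ → ℝ}

/-- A Carathéodory function agrees almost everywhere with a jointly measurable one. -/
lemma IsCaratheodoryOn.exists_measurable (hf : IsCaratheodoryOn Ω f) :
    ∃ F : RN N → ℝ → ℝ, Measurable (Function.uncurry F) ∧
      ∀ᵐ x ∂(volume.restrict Ω), ∀ t, f x t = F x t := by
  set μ := (volume : Measure (RN N)).restrict Ω
  set A : ℚ → RN N → ℝ := fun q => (hf.1 q).mk
  have hA : ∀ᵐ x ∂μ, ∀ q : ℚ, f x q = A q x := ae_all_iff.2 fun q => (hf.1 q).ae_eq_mk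
  set S : Set (RN N) := {x | Continuous (f x) ∧ ∀ q : ℚ, f x q = A q x}
  have hS : ∀ᵐ x ∂μ, x ∈ S := hf.2.and hA
  set Z := toMeasurable μ Sᶜ
  have hZ0 : μ Z = 0 := (measure_toMeasurable _).trans (mem_ae_iff.1 hS)
  have hZm : MeasurableSet Z := measurableSet_toMeasurable _ _
  have hZS : ∀ x ∉ Z, x ∈ S := fun x hx => by
    by_contra h
    exact hx (subset_toMeasurable μ _ h)
  classical
  -- Setting f to zero on a measurable null set makes every section continuous. Measurability at
  -- real t then follows from rational approximations.
  set F : RN N → ℝ → ℝ := fun x t => if x ∈ Z then 0 else f x t with hF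
  have hFc : ∀ x, Continuous (F x) := by
    intro x
    by_cases hx : x ∈ Z
    · have : F x = fun _ => 0 := by funext t; simp [hF, hx]
      rw [this]
      exact continuous_const
    · have : F x = f x := by funext t; simp [hF, hx]
      rw [this]
      exact (hZS x hx).1
  have hFq : ∀ q : ℚ, Measurable fun x => F x q := by
    intro q
    have : (fun x => F x q) = fun x => if x ∈ Z then 0 else A q x := by
      funext x
      by_cases hx : x ∈ Z
      · simp [hF, hx]
      · simp [hF, hx, (hZS x hx).2 q]
    rw [this]
    exact Measurable.ite hZm measurable_const (hf.1 q).measurable_mk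
  have hFm : ∀ t, Measurable fun x => F x t := by
    intro t
    have hex : ∀ n : ℕ, ∃ q : ℚ, t < q ∧ (q : ℝ) < t + 1 / ((n : ℝ) + 1) := fun n =>
      exists_rat_btwn (lt_add_of_pos_right t Nat.one_div_pos_of_nat)
    choose q hq1 hq2 using hex
    have hq : Tendsto (fun n => (q n : ℝ)) atTop (𝓝 t) := by
      refine tendsto_of_tendsto_of_tendsto_of_le_of_le tendsto_const_nhds ?_
        (fun n => (hq1 n).le) (fun n => (hq2 n).le)
      simpa using tendsto_one_div_add_atTop_nhds_zero_nat.const_add t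
    refine measurable_of_tendsto_metrizable (fun n => hFq (q n)) ?_
    rw [tendsto_pi_nhds]
    exact fun x => ((hFc x).tendsto t).comp hq
  refine ⟨F, ?_, ?_⟩
  · have h := measurable_uncurry_of_continuous_of_measurable (u := fun t x => F x t) hFc hFm
    exact h.comp measurable_swap
  · have : ∀ᵐ x ∂μ, x ∉ Z := measure_eq_zero_iff_ae_notMem.1 hZ0
    filter_upwards [this] with x hx t
    simp [hF, hx]

/-- Integrability of the potential `F(x, U(x))` along a bounded measurable function `U`. -/
lemma IsCaratheodoryOn.integrable_potential [IsFiniteMeasure (volume.restrict Ω)]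
    (hf : IsCaratheodoryOn Ω f) {M B : ℝ}
    (hB : ∀ᵐ x ∂(volume.restrict Ω), ∀ t : ℝ, |t| ≤ M → |f x t| ≤ B) {U : RN N → ℝ}
    (hU : AEMeasurable U (volume.restrict Ω)) (hM : ∀ᵐ x ∂(volume.restrict Ω), |U x| ≤ M) :
    Integrable (fun x => ∫ s in (0 : ℝ)..(U x), f x s) (volume.restrict Ω) := by
  obtain ⟨F, hF, hfF⟩ := hf.exists_measurable
  have hmeas : AEStronglyMeasurable (fun x => ∫ s in (0 : ℝ)..(U x), f x s)
      (volume.restrict Ω) := by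
    set V := hU.mk
    have hV : Measurable V := hU.measurable_mk
    -- Rescaling the variable endpoint to [0,1] reduces measurability to that of a parametric
    -- integral over a fixed interval.
    have h1 : StronglyMeasurable fun x => V x * ∫ s in (0 : ℝ)..1, F x (V x * s) := by
      have h2 : Measurable fun p : RN N × ℝ => F p.1 (V p.1 * p.2) :=
        hF.comp (measurable_fst.prodMk ((hV.comp measurable_fst).mul measurable_snd))
      have h3 : StronglyMeasurable fun x => ∫ s in Ioc (0 : ℝ) 1, F x (V x * s) :=
        h2.stronglyMeasurable.integral_prod_right
      simp only [intervalIntegral.integral_of_le (zero_le_one (α := ℝ))]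
      exact hV.stronglyMeasurable.mul h3
    refine ⟨_, h1, ?_⟩
    filter_upwards [hfF, hU.ae_eq_mk] with x h2 h3
    rw [intervalIntegral.mul_integral_comp_mul_left, mul_zero, mul_one, show V x = U x from h3.symm]
    exact intervalIntegral.integral_congr fun s _ => h2 s
  refine Integrable.of_bound hmeas (B * M) ?_
  filter_upwards [hB, hM] with x h1 h2
  have hB0 : 0 ≤ B := (abs_nonneg _).trans (h1 (U x) h2)
  have h3 := intervalIntegral.norm_integral_le_of_norm_le_const (a := 0) (b := U x) (f := f x)
    (C := B) fun s hs => by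
      refine h1 s ?_
      rw [uIoc_eq_union] at hs
      rcases hs with hs | hs
      · rw [abs_of_pos hs.1]
        exact hs.2.trans ((le_abs_self _).trans h2)
      · rw [abs_of_nonpos hs.2]
        exact (neg_le_neg hs.1.le).trans ((neg_le_abs _).trans h2)
  refine h3.trans ?_
  rw [sub_zero]
  exact mul_le_mul_of_nonneg_left h2 hB0

end Caratheodory

/-! ### Secant bounds for a convex function and its primitive. -/

section Convexity

variable {J : Set ℝ} {f : ℝ → ℝ} {u p : ℝ}

/-- Here `u` is the convex combination of u + τp and u - p with weights 1/(1+τ) and τ/(1+τ). -/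
lemma ConvexOn.le_secant_extension (hf : ConvexOn ℝ J f) (hJ : ∀ τ, -1 ≤ τ → u + τ * p ∈ J) {τ : ℝ}
    (hτ : 0 ≤ τ) : f u + τ * (f u - f (u - p)) ≤ f (u + τ * p) := by
  have h1 : u + -1 * p ∈ J := hJ (-1) le_rfl
  have hpos : 0 < 1 + τ := by linarith
  have h := hf.2 (hJ τ (by linarith)) h1 (show 0 ≤ 1 / (1 + τ) by positivity)
    (show 0 ≤ τ / (1 + τ) by positivity) (by field_simp)
  simp only [smul_eq_mul] at h
  have h2 : 1 / (1 + τ) * (u + τ * p) + τ / (1 + τ) * (u + -1 * p) = u := by field_simp; ring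
  have h3 : u + -1 * p = u - p := by ring
  rw [h2, h3] at h
  have h4 := mul_le_mul_of_nonneg_left h hpos.le
  have h5 : (1 + τ) * (1 / (1 + τ) * f (u + τ * p) + τ / (1 + τ) * f (u - p)) =
      f (u + τ * p) + τ * f (u - p) := by field_simp
  rw [h5] at h4
  linarith

/-- Here u + τp is itself the convex combination of `u` and u - p, with weights 1+τ and -τ. -/
lemma ConvexOn.le_secant (hf : ConvexOn ℝ J f) (hJ : ∀ τ, -1 ≤ τ → u + τ * p ∈ J) {τ : ℝ}
    (hτ1 : -1 ≤ τ) (hτ : τ ≤ 0) : f (u + τ * p) ≤ f u + τ * (f u - f (u - p)) := by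
  have h1 : u + -1 * p ∈ J := hJ (-1) le_rfl
  have h0 : u + 0 * p ∈ J := hJ 0 (by norm_num)
  have h := hf.2 h0 h1 (show 0 ≤ 1 + τ by linarith) (show 0 ≤ -τ by linarith) (by ring)
  simp only [smul_eq_mul] at h
  have h2 : (1 + τ) * (u + 0 * p) + -τ * (u + -1 * p) = u + τ * p := by ring
  have h3 : u + -1 * p = u - p := by ring
  rw [h2, h3, zero_mul, add_zero] at h
  linarith

lemma StrictConvexOn.lt_secant_extension (hf : StrictConvexOn ℝ J f) (hp : 0 < p)
    (hJ : ∀ τ, -1 ≤ τ → u + τ * p ∈ J) {τ : ℝ}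
    (hτ : 0 < τ) : f u + τ * (f u - f (u - p)) < f (u + τ * p) := by
  have h1 : u + -1 * p ∈ J := hJ (-1) le_rfl
  have hpos : 0 < 1 + τ := by linarith
  have hne : u + τ * p ≠ u + -1 * p := by
    have := mul_pos hτ hp
    intro h
    linarith
  have h := hf.2 (hJ τ (by linarith)) h1 hne (show 0 < 1 / (1 + τ) by positivity)
    (show 0 < τ / (1 + τ) by positivity) (by field_simp)
  simp only [smul_eq_mul] at h
  have h2 : 1 / (1 + τ) * (u + τ * p) + τ / (1 + τ) * (u + -1 * p) = u := by field_simp; ring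
  have h3 : u + -1 * p = u - p := by ring
  rw [h2, h3] at h
  have h4 := mul_lt_mul_of_pos_left h hpos
  have h5 : (1 + τ) * (1 / (1 + τ) * f (u + τ * p) + τ / (1 + τ) * f (u - p)) =
      f (u + τ * p) + τ * f (u - p) := by field_simp
  rw [h5] at h4
  linarith

lemma StrictConvexOn.lt_secant (hf : StrictConvexOn ℝ J f) (hp : 0 < p)
    (hJ : ∀ τ, -1 ≤ τ → u + τ * p ∈ J) {τ : ℝ}
    (hτ1 : -1 < τ) (hτ : τ < 0) : f (u + τ * p) < f u + τ * (f u - f (u - p)) := by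
  have h1 : u + -1 * p ∈ J := hJ (-1) le_rfl
  have h0 : u + 0 * p ∈ J := hJ 0 (by norm_num)
  have hne : u + 0 * p ≠ u + -1 * p := fun h => by linarith
  have h := hf.2 h0 h1 hne (show 0 < 1 + τ by linarith) (show 0 < -τ by linarith) (by ring)
  simp only [smul_eq_mul] at h
  have h2 : (1 + τ) * (u + 0 * p) + -τ * (u + -1 * p) = u + τ * p := by ring
  have h3 : u + -1 * p = u - p := by ring
  rw [h2, h3, zero_mul, add_zero] at h
  linarith

lemma integral_affine (a d m : ℝ) : ∫ τ in (0 : ℝ)..m, (a + τ * d) = m * a + m ^ 2 / 2 * d := by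
  rw [intervalIntegral.integral_add (by simp)
    (Continuous.intervalIntegrable (by fun_prop) _ _)]
  simp

lemma integral_sub_eq_smul (hfc : Continuous f) (u p m : ℝ) :
    (∫ s in (0 : ℝ)..(u + m * p), f s) - ∫ s in (0 : ℝ)..u, f s =
      p * ∫ τ in (0 : ℝ)..m, f (u + τ * p) := by
  rw [intervalIntegral.integral_interval_sub_left (hfc.intervalIntegrable _ _)
    (hfc.intervalIntegrable _ _)]
  have h := intervalIntegral.mul_integral_comp_add_mul (a := 0) (b := m) (f := f) p u
  simp only [mul_comm _ p] at h ⊢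
  rw [h]
  simp

/-- Convexity of `f` bounds the increment of its primitive along `u + m p` from below by a quadratic
polynomial in `m`. -/
lemma ConvexOn.le_integral_increment (hf : ConvexOn ℝ J f) (hfc : Continuous f) (hp : 0 < p)
    (hJ : ∀ τ, -1 ≤ τ → u + τ * p ∈ J) {m : ℝ} (hm : -1 ≤ m) :
    m * f u * p + m ^ 2 / 2 * ((f u - f (u - p)) * p) ≤
      (∫ s in (0 : ℝ)..(u + m * p), f s) - ∫ s in (0 : ℝ)..u, f s := by
  have hc1 : Continuous fun τ : ℝ => f u + τ * (f u - f (u - p)) := by fun_prop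
  have hc2 : Continuous fun τ : ℝ => f (u + τ * p) := by fun_prop
  have key : (∫ τ in (0 : ℝ)..m, (f u + τ * (f u - f (u - p)))) ≤
      ∫ τ in (0 : ℝ)..m, f (u + τ * p) := by
    rcases le_total 0 m with h | h
    · exact intervalIntegral.integral_mono_on h (hc1.intervalIntegrable _ _)
        (hc2.intervalIntegrable _ _) fun τ hτ => hf.le_secant_extension hJ hτ.1
    -- For m ≤ 0 the secant inequality reverses, and so does the orientation of the integral.
    · rw [intervalIntegral.integral_symm, intervalIntegral.integral_symm m]
      exact neg_le_neg (intervalIntegral.integral_mono_on h (hc2.intervalIntegrable _ _)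
        (hc1.intervalIntegrable _ _) fun τ hτ => hf.le_secant hJ (hm.trans hτ.1) hτ.2)
  rw [integral_sub_eq_smul hfc, integral_affine] at *
  nlinarith [mul_le_mul_of_nonneg_left key hp.le]

lemma StrictConvexOn.lt_integral_increment (hf : StrictConvexOn ℝ J f) (hfc : Continuous f)
    (hp : 0 < p) (hJ : ∀ τ, -1 ≤ τ → u + τ * p ∈ J) {m : ℝ} (hm : -1 ≤ m) (hm0 : m ≠ 0) :
    m * f u * p + m ^ 2 / 2 * ((f u - f (u - p)) * p) <
      (∫ s in (0 : ℝ)..(u + m * p), f s) - ∫ s in (0 : ℝ)..u, f s := by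
  have hc1 : Continuous fun τ : ℝ => f u + τ * (f u - f (u - p)) := by fun_prop
  have hc2 : Continuous fun τ : ℝ => f (u + τ * p) := by fun_prop
  have key : (∫ τ in (0 : ℝ)..m, (f u + τ * (f u - f (u - p)))) <
      ∫ τ in (0 : ℝ)..m, f (u + τ * p) := by
    rcases lt_or_gt_of_ne hm0.symm with h | h
    · refine intervalIntegral.integral_lt_integral_of_continuousOn_of_le_of_exists_lt h
        hc1.continuousOn hc2.continuousOn
        (fun τ hτ => hf.convexOn.le_secant_extension hJ hτ.1.le)
        ⟨m, right_mem_Icc.2 h.le, hf.lt_secant_extension hp hJ h⟩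
    · rw [intervalIntegral.integral_symm, intervalIntegral.integral_symm m]
      refine neg_lt_neg (intervalIntegral.integral_lt_integral_of_continuousOn_of_le_of_exists_lt h
        hc2.continuousOn hc1.continuousOn
        (fun τ hτ => hf.convexOn.le_secant hJ (hm.trans hτ.1.le) hτ.2)
        -- The midpoint avoids both τ = 0 and τ = -1, where the secant meets the graph; m = -1 is
        -- allowed.
        ⟨m / 2, ⟨by linarith, by linarith⟩,
          hf.lt_secant hp hJ (by linarith) (by linarith)⟩)
  rw [integral_sub_eq_smul hfc, integral_affine] at *
  nlinarith [mul_lt_mul_of_pos_left key hp]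

end Convexity

/-! ### Planes spanned by two orthogonal vectors. -/

section Orthogonal

variable {H : Type*} [NormedAddCommGroup H] [InnerProductSpace ℝ H] {p q : H}

lemma finrank_span_pair_of_orthogonal (hp : p ≠ 0) (hq : q ≠ 0) (hpq : inner ℝ p q = 0) :
    Module.finrank ℝ (Submodule.span ℝ {p, q}) = 2 := by
  have hli : LinearIndependent ℝ ![p, q] := by
    refine linearIndependent_of_ne_zero_of_inner_eq_zero ?_ ?_
    · intro i
      fin_cases i
      · exact hp
      · exact hq
    · intro i j hij
      fin_cases i <;> fin_cases j
      · exact absurd rfl hij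
      · exact hpq
      · exact (real_inner_comm _ _).trans hpq
      · exact absurd rfl hij
  have h := finrank_span_eq_card hli
  rw [Matrix.range_cons_cons_empty] at h
  simpa using h

lemma abs_mul_norm_le_of_orthogonal (hpq : inner ℝ p q = 0) (s t : ℝ) :
    |s| * ‖p‖ ≤ ‖s • p + t • q‖ := by
  have h := norm_add_sq_real (s • p) (t • q)
  rw [real_inner_smul_left, real_inner_smul_right, hpq, norm_smul, Real.norm_eq_abs] at h
  refine le_of_sq_le_sq ?_ (norm_nonneg _)
  nlinarith [sq_nonneg ‖t • q‖]

/-- By orthogonality each component is no longer than s•p + t•q, so the ball of radius min(‖p‖, ‖q‖)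
forces both coefficients into [-1, 1]. -/
lemma eventually_of_forall_coeff_le_one {w₀ : H} (hp : p ≠ 0) (hq : q ≠ 0)
    (hpq : inner ℝ p q = 0) {Q : H → Prop}
    (hQ : ∀ s t : ℝ, |s| ≤ 1 → |t| ≤ 1 → Q (w₀ + (s • p + t • q))) :
    ∀ᶠ w in 𝓝[{w | w - w₀ ∈ Submodule.span ℝ {p, q}}] w₀, Q w := by
  have hp0 : 0 < ‖p‖ := norm_pos_iff.2 hp
  have hq0 : 0 < ‖q‖ := norm_pos_iff.2 hq
  rw [eventually_nhdsWithin_iff]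
  filter_upwards [Metric.ball_mem_nhds w₀ (lt_min hp0 hq0)] with w hw hwV
  obtain ⟨s, t, hst⟩ := Submodule.mem_span_pair.1 hwV
  have hw' : w = w₀ + (s • p + t • q) := by rw [hst]; abel
  rw [Metric.mem_ball, dist_eq_norm, ← hst, lt_min_iff] at hw
  rw [hw']
  refine hQ s t ?_ ?_
  · exact le_of_mul_le_mul_right (by
      rw [one_mul]; exact (abs_mul_norm_le_of_orthogonal hpq s t).trans hw.1.le) hp0
  · refine le_of_mul_le_mul_right ?_ hq0
    have h := abs_mul_norm_le_of_orthogonal ((real_inner_comm p q).trans hpq) t s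
    rw [add_comm] at h
    rw [one_mul]
    exact h.trans hw.2.le

end Orthogonal

/-! ### Expansion of the energy along the plane. -/

section Energy

variable {N : ℕ} {Ω : Set (RN N)} {f : RN N → ℝ → ℝ}

namespace H10

/-- The Dirichlet form `∫_Ω ∇v · ∇w`. -/
def dirichlet (v w : H10 Ω) : ℝ := inner ℝ (v : L2Pair Ω).snd (w : L2Pair Ω).snd

lemma dirichlet_eq (v w : H10 Ω) :
    dirichlet v w = ∫ x in Ω, inner ℝ (grad v x) (grad w x) := by
  rw [dirichlet, L2.inner_def]
  rfl

lemma dirichlet_self_add (v p q : H10 Ω) (s t : ℝ) (hpq : dirichlet p q = 0) :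
    dirichlet (v + (s • p + t • q)) (v + (s • p + t • q)) = dirichlet v v +
      2 * (s * dirichlet v p + t * dirichlet v q) + s ^ 2 * dirichlet p p +
        t ^ 2 * dirichlet q q := by
  have h : ((v + (s • p + t • q) : H10 Ω) : L2Pair Ω).snd =
      (v : L2Pair Ω).snd + (s • (p : L2Pair Ω).snd + t • (q : L2Pair Ω).snd) := rfl
  simp only [dirichlet] at hpq ⊢
  rw [h]
  have h1 := (real_inner_comm (p : L2Pair Ω).snd (q : L2Pair Ω).snd).trans hpq
  have h2 := real_inner_comm (v : L2Pair Ω).snd (p : L2Pair Ω).snd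
  have h3 := real_inner_comm (v : L2Pair Ω).snd (q : L2Pair Ω).snd
  simp only [inner_add_left, inner_add_right, real_inner_smul_left, real_inner_smul_right, hpq, h1,
    h2, h3]
  ring

end H10

open H10

lemma energy_eq (w : H10 Ω)
    (hw : Integrable (fun x => ∫ s in (0 : ℝ)..(toFun w x), f x s) (volume.restrict Ω)) :
    energy Ω f w = 1 / 2 * dirichlet w w - ∫ x in Ω, ∫ s in (0 : ℝ)..(toFun w x), f x s := by
  have hg : Integrable (fun x => (1 / 2 : ℝ) * ‖grad w x‖ ^ 2) (volume.restrict Ω) :=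
    ((memLp_two_iff_integrable_sq_norm (memLp_grad w).1).1 (memLp_grad w)).const_mul _
  rw [energy, integral_sub hg hw, integral_const_mul, dirichlet_eq]
  simp only [real_inner_self_eq_norm_sq]

/-- The density of the energy increment in the direction `m • w`, where `a` and `h` stand for the
densities of the linear and the quadratic part of the Dirichlet energy. -/
def incrementDensity (f : RN N → ℝ → ℝ) (u w a h : RN N → ℝ) (m : ℝ) (x : RN N) : ℝ :=
  m * (a x * w x) + m ^ 2 / 2 * (h x * w x) -
    ((∫ τ in (0 : ℝ)..(u x + m * w x), f x τ) - ∫ τ in (0 : ℝ)..(u x), f x τ)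

set_option maxHeartbeats 1000000 in
/-- The energy increment in the direction of two functions with disjoint supports. -/
theorem energy_add_sub [IsFiniteMeasure (volume.restrict Ω)] {w₀ p q : H10 Ω}
    {u w a h : RN N → ℝ} {D₁ D₂ : Set (RN N)} (hD₁ : MeasurableSet D₁) (hD₂ : MeasurableSet D₂)
    (hdisj : Disjoint D₁ D₂) (hu : toFun w₀ =ᵐ[volume.restrict Ω] u)
    (hp : toFun p =ᵐ[volume.restrict Ω] D₁.indicator w)
    (hq : toFun q =ᵐ[volume.restrict Ω] D₂.indicator w) (hpq : dirichlet p q = 0)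
    (ha : Integrable (fun x => a x * w x) (volume.restrict Ω))
    (hh : Integrable (fun x => h x * w x) (volume.restrict Ω))
    (hlin₁ : dirichlet w₀ p = ∫ x in Ω, D₁.indicator (fun x => a x * w x) x)
    (hlin₂ : dirichlet w₀ q = ∫ x in Ω, D₂.indicator (fun x => a x * w x) x)
    (hquad₁ : dirichlet p p = ∫ x in Ω, D₁.indicator (fun x => h x * w x) x)
    (hquad₂ : dirichlet q q = ∫ x in Ω, D₂.indicator (fun x => h x * w x) x)
    (hpot : ∀ s t : ℝ, Integrable (fun x => ∫ τ in (0 : ℝ)..(toFun (w₀ + (s • p + t • q)) x), f x τ)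
      (volume.restrict Ω)) (s t : ℝ) :
    Integrable (fun x => D₁.indicator (incrementDensity f u w a h s) x +
        D₂.indicator (incrementDensity f u w a h t) x) (volume.restrict Ω) ∧
      energy Ω f (w₀ + (s • p + t • q)) - energy Ω f w₀ =
        ∫ x in Ω, (D₁.indicator (incrementDensity f u w a h s) x +
          D₂.indicator (incrementDensity f u w a h t) x) := by
  obtain ⟨W, hW⟩ : ∃ W, W = w₀ + (s • p + t • q) := ⟨_, rfl⟩
  have hpotW := hW ▸ hpot s t
  rw [← hW]
  have hpot0 : Integrable (fun x => ∫ τ in (0 : ℝ)..(toFun w₀ x), f x τ) (volume.restrict Ω) := by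
    have := hpot 0 0
    rwa [zero_smul, zero_smul, add_zero, add_zero] at this
  have ha1 := ha.indicator hD₁
  have ha2 := ha.indicator hD₂
  have hh1 := hh.indicator hD₁
  have hh2 := hh.indicator hD₂
  have hWae : toFun W =ᵐ[volume.restrict Ω]
      fun x => u x + (s * D₁.indicator w x + t * D₂.indicator w x) := by
    filter_upwards [toFun_add w₀ (s • p + t • q), toFun_add (s • p) (t • q), toFun_smul s p,
      toFun_smul t q, hu, hp, hq] with x h1 h2 h3 h4 h5 h6 h7
    rw [hW, h1, Pi.add_apply, h2, Pi.add_apply, h3, h4, Pi.smul_apply, Pi.smul_apply, h5, h6, h7]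
    rfl
  have hae : ∀ᵐ x ∂(volume.restrict Ω),
      (s * D₁.indicator (fun x => a x * w x) x + s ^ 2 / 2 * D₁.indicator (fun x => h x * w x) x) +
      (t * D₂.indicator (fun x => a x * w x) x + t ^ 2 / 2 * D₂.indicator (fun x => h x * w x) x) -
      ((∫ τ in (0 : ℝ)..(toFun W x), f x τ) - ∫ τ in (0 : ℝ)..(toFun w₀ x), f x τ) =
      D₁.indicator (incrementDensity f u w a h s) x +
        D₂.indicator (incrementDensity f u w a h t) x := by
    -- At each point at most one of the two directions is active, so even the nonlinear term
    -- separates in `s` and `t`.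
    filter_upwards [hWae, hu] with x h1 h2
    rw [h1, h2]
    by_cases hx1 : x ∈ D₁
    · have hx2 : x ∉ D₂ := disjoint_left.1 hdisj hx1
      simp only [indicator_of_mem hx1, indicator_of_notMem hx2, mul_zero, add_zero,
        incrementDensity]
    · by_cases hx2 : x ∈ D₂
      · simp only [indicator_of_mem hx2, indicator_of_notMem hx1, mul_zero, zero_add,
          incrementDensity]
      · simp only [indicator_of_notMem hx1, indicator_of_notMem hx2, mul_zero, add_zero, sub_self]
  have hi1 : Integrable (fun x => s * D₁.indicator (fun x => a x * w x) x +
      s ^ 2 / 2 * D₁.indicator (fun x => h x * w x) x) (volume.restrict Ω) :=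
    (ha1.const_mul s).add (hh1.const_mul (s ^ 2 / 2))
  have hi2 : Integrable (fun x => t * D₂.indicator (fun x => a x * w x) x +
      t ^ 2 / 2 * D₂.indicator (fun x => h x * w x) x) (volume.restrict Ω) :=
    (ha2.const_mul t).add (hh2.const_mul (t ^ 2 / 2))
  have hi3 : Integrable (fun x => (∫ τ in (0 : ℝ)..(toFun W x), f x τ) -
      ∫ τ in (0 : ℝ)..(toFun w₀ x), f x τ) (volume.restrict Ω) := hpotW.sub hpot0
  have hi12 : Integrable (fun x => s * D₁.indicator (fun x => a x * w x) x +
      s ^ 2 / 2 * D₁.indicator (fun x => h x * w x) x +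
      (t * D₂.indicator (fun x => a x * w x) x +
      t ^ 2 / 2 * D₂.indicator (fun x => h x * w x) x)) (volume.restrict Ω) := hi1.add hi2
  refine ⟨(hi12.sub hi3).congr hae, ?_⟩
  rw [← integral_congr_ae hae, integral_sub hi12 hi3, integral_add hi1 hi2,
    integral_add (ha1.const_mul s) (hh1.const_mul (s ^ 2 / 2)),
    integral_add (ha2.const_mul t) (hh2.const_mul (t ^ 2 / 2)), integral_sub hpotW hpot0]
  simp only [integral_const_mul]
  rw [energy_eq W hpotW, energy_eq w₀ hpot0, hW, dirichlet_self_add _ _ _ _ _ hpq, hlin₁,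
    hlin₂, hquad₁, hquad₂]
  ring

end Energy

/-! ### The two half-space bumps and the sign of the energy increment. -/

section Assembly

variable {N : ℕ} {Ω : Set (RN N)}

/-- Splits the boundary of the half domain into the two places where the odd function `w` is known
to vanish. -/
lemma closure_inter_halfSpace_sdiff_subset (Ω : Set (RN N)) (e : RN N) :
    closure (Ω ∩ {x | 0 < inner ℝ x e}) \ (Ω ∩ {x | 0 < inner ℝ x e}) ⊆
      {x | x ∈ closure Ω \ Ω ∨ (x ∈ Ω ∧ inner ℝ x e = 0)} := by
  rintro x ⟨h1, h2⟩
  have h3 : x ∈ closure Ω := closure_mono inter_subset_left h1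
  by_cases hx : x ∈ Ω
  · refine Or.inr ⟨hx, le_antisymm (not_lt.1 fun h => h2 ⟨hx, h⟩) ?_⟩
    have h4 : closure (Ω ∩ {x | 0 < inner ℝ x e}) ⊆ {x : RN N | 0 ≤ inner ℝ x e} :=
      closure_minimal (fun y hy => by
        have h5 : 0 < inner ℝ y e := hy.2
        exact h5.le)
        (isClosed_le continuous_const (continuous_id.inner continuous_const))
    exact h4 h1
  · exact Or.inl ⟨h3, hx⟩

open H10

/-- The part of a classical function vanishing on `∂Ω` and on `eᗮ` which is positive on one side of
`eᗮ`, as an element of `H¹₀(Ω)`. -/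
theorem H10.exists_halfSpace_posPart (hΩ : IsOpen Ω) (hΩb : Bornology.IsBounded Ω)
    {w : RN N → ℝ} (hw : ContDiffOn ℝ 2 w Ω) (hwc : ContinuousOn w (closure Ω))
    (h0 : ∀ x ∈ closure Ω \ Ω, w x = 0) {B : ℝ} (hB : ∀ x ∈ Ω, |Laplacian.laplacian w x| ≤ B)
    {e : RN N} (hwe : ∀ x ∈ Ω, inner ℝ x e = 0 → w x = 0)
    (hex : ∃ x ∈ Ω, 0 < inner ℝ x e ∧ 0 < w x) {D : Set (RN N)}
    (hD : D = (Ω ∩ {x | 0 < inner ℝ x e}) ∩ {x | 0 < w x}) :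
    IsOpen D ∧ 0 < volume.restrict Ω D ∧ ∃ p : H10 Ω, IsSignDefinite p ∧
      toFun p =ᵐ[volume.restrict Ω] D.indicator w ∧
      grad p =ᵐ[volume.restrict Ω] D.indicator (gradient w) ∧
      dirichlet p p = ∫ x in Ω, D.indicator (fun x => -Laplacian.laplacian w x * w x) x := by
  have hSo : IsOpen (Ω ∩ {x | 0 < inner ℝ x e}) :=
    hΩ.inter (isOpen_lt continuous_const (continuous_id.inner continuous_const))
  have hDΩ : D ⊆ Ω := by
    rw [hD]
    exact inter_subset_left.trans inter_subset_left
  have hDo : IsOpen D := by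
    rw [hD]
    exact (hw.continuousOn.mono inter_subset_left).isOpen_inter_preimage hSo isOpen_Ioi
  have hDpos : 0 < volume.restrict Ω D := by
    rw [Measure.restrict_apply hDo.measurableSet, inter_eq_left.2 hDΩ]
    obtain ⟨x, hx1, hx2, hx3⟩ := hex
    exact hDo.measure_pos _ ⟨x, by rw [hD]; exact ⟨⟨hx1, hx2⟩, hx3⟩⟩
  have hwD : ∀ x ∈ D, 0 < w x := fun x hx => by
    rw [hD] at hx
    exact hx.2
  obtain ⟨p, hp1, hp2, hp3⟩ := exists_posPart hΩ hΩb hSo inter_subset_left hw hwc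
    (fun x hx => by
      rcases closure_inter_halfSpace_sdiff_subset Ω e hx with h | h
      · exact h0 x h
      · exact hwe x h.1 h.2) hB
  rw [← hD] at hp1 hp2 hp3
  refine ⟨hDo, hDpos, p, ⟨?_, Or.inl ?_⟩, hp1, hp2, ?_⟩
  · rintro rfl
    have hz : toFun (0 : H10 Ω) =ᵐ[volume.restrict Ω] 0 := Lp.coeFn_zero _ _ _
    have hnull : volume.restrict Ω D = 0 := by
      refine measure_mono_null (fun x hx => ?_) (mem_ae_iff.1 (hz.symm.trans hp1))
      intro h
      have h1 : (0 : ℝ) = D.indicator w x := h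
      rw [indicator_of_mem hx] at h1
      exact (hwD x hx).ne h1
    exact hDpos.ne' hnull
  · filter_upwards [hp1] with x hx
    rw [hx]
    exact indicator_nonneg (fun y hy => (hwD y hy).le) x
  · have h1 : dirichlet p p = ∫ x in Ω, D.indicator (fun x => ‖gradient w x‖ ^ 2) x := by
      rw [dirichlet_eq]
      refine integral_congr_ae ?_
      filter_upwards [hp2] with x hx
      rw [hx, real_inner_self_eq_norm_sq]
      by_cases hxD : x ∈ D
      · simp only [indicator_of_mem hxD]
      · simp [indicator_of_notMem hxD]
    rw [h1, setIntegral_indicator hDo.measurableSet, setIntegral_indicator hDo.measurableSet,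
      inter_eq_right.2 hDΩ, hp3, ← integral_neg]
    refine integral_congr_ae (Eventually.of_forall fun x => ?_)
    simp only
    ring

lemma dirichlet_eq_zero_of_disjoint {p q : H10 Ω} {D₁ D₂ : Set (RN N)} {G₁ G₂ : RN N → RN N}
    (hdisj : Disjoint D₁ D₂) (hp : grad p =ᵐ[volume.restrict Ω] D₁.indicator G₁)
    (hq : grad q =ᵐ[volume.restrict Ω] D₂.indicator G₂) : dirichlet p q = 0 := by
  rw [dirichlet_eq, ← integral_zero (RN N) ℝ (μ := volume.restrict Ω)]
  refine integral_congr_ae ?_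
  filter_upwards [hp, hq] with x h1 h2
  rw [h1, h2]
  by_cases hx : x ∈ D₁
  · rw [indicator_of_notMem (disjoint_left.1 hdisj hx), inner_zero_right]
  · rw [indicator_of_notMem hx, inner_zero_left]

lemma inner_eq_zero_of_disjoint {p q : H10 Ω} {D₁ D₂ : Set (RN N)} {v : RN N → ℝ}
    (hdisj : Disjoint D₁ D₂) (hp : toFun p =ᵐ[volume.restrict Ω] D₁.indicator v)
    (hq : toFun q =ᵐ[volume.restrict Ω] D₂.indicator v) (hpq : dirichlet p q = 0) :
    inner ℝ p q = 0 := by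
  rw [H10.inner_eq, ← dirichlet_eq, hpq, add_zero, ← integral_zero (RN N) ℝ
    (μ := volume.restrict Ω)]
  refine integral_congr_ae ?_
  filter_upwards [hp, hq] with x h1 h2
  rw [h1, h2]
  by_cases hx : x ∈ D₁
  · rw [indicator_of_notMem (disjoint_left.1 hdisj hx), inner_zero_right]
  · rw [indicator_of_notMem hx, inner_zero_left]

/-- Local maximality of the energy on the plane spanned by the two halves `p`, `q` of the positive
part of the difference `w` of two solutions. -/
theorem energy_local_max (hΩ : IsOpen Ω) [IsFiniteMeasure (volume.restrict Ω)]
    {f : RN N → ℝ → ℝ} (hf : IsCaratheodoryOn Ω f)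
    (hfb : ∀ M : ℝ, ∃ B : ℝ, ∀ᵐ x ∂(volume.restrict Ω), ∀ t : ℝ, |t| ≤ M → |f x t| ≤ B)
    {w₀ p q : H10 Ω} {u w a h : RN N → ℝ} {D₁ D₂ : Set (RN N)} (hD₁ : MeasurableSet D₁)
    (hD₂ : MeasurableSet D₂) (hdisj : Disjoint D₁ D₂)
    (hμ₁ : 0 < volume.restrict Ω D₁) (hμ₂ : 0 < volume.restrict Ω D₂)
    (hw₁ : ∀ x ∈ D₁, 0 < w x) (hw₂ : ∀ x ∈ D₂, 0 < w x)
    (hu : toFun w₀ =ᵐ[volume.restrict Ω] u)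
    (hp : toFun p =ᵐ[volume.restrict Ω] D₁.indicator w)
    (hq : toFun q =ᵐ[volume.restrict Ω] D₂.indicator w) (hpq : dirichlet p q = 0)
    (hac : ContinuousOn a Ω) (hhc : ContinuousOn h Ω) (hwc : ContinuousOn w Ω) {M A : ℝ}
    (huM : ∀ x ∈ Ω, |u x| ≤ M) (hwM : ∀ x ∈ Ω, |w x| ≤ M) (haA : ∀ x ∈ Ω, |a x| ≤ A)
    (hhA : ∀ x ∈ Ω, |h x| ≤ A)
    (hlin₁ : dirichlet w₀ p = ∫ x in Ω, D₁.indicator (fun x => a x * w x) x)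
    (hlin₂ : dirichlet w₀ q = ∫ x in Ω, D₂.indicator (fun x => a x * w x) x)
    (hquad₁ : dirichlet p p = ∫ x in Ω, D₁.indicator (fun x => h x * w x) x)
    (hquad₂ : dirichlet q q = ∫ x in Ω, D₂.indicator (fun x => h x * w x) x)
    (haf : ∀ x ∈ Ω, a x = f x (u x)) (hhf : ∀ x ∈ Ω, h x = f x (u x) - f x (u x - w x))
    {J : Set ℝ} (hJ : ∀ x ∈ Ω, 0 < w x → ∀ τ : ℝ, -1 ≤ τ → u x + τ * w x ∈ J)
    (hconv : ∀ᵐ x ∂(volume.restrict Ω), ConvexOn ℝ J (f x)) {s t : ℝ} (hs : |s| ≤ 1)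
    (ht : |t| ≤ 1) :
    energy Ω f (w₀ + (s • p + t • q)) ≤ energy Ω f w₀ ∧
      ((∀ᵐ x ∂(volume.restrict Ω), StrictConvexOn ℝ J (f x)) → w₀ + (s • p + t • q) ≠ w₀ →
        energy Ω f (w₀ + (s • p + t • q)) < energy Ω f w₀) := by
  have hΩm := hΩ.measurableSet
  have hmul : ∀ b : RN N → ℝ, ContinuousOn b Ω → (∀ x ∈ Ω, |b x| ≤ A) →
      Integrable (fun x => b x * w x) (volume.restrict Ω) := by
    intro b hb hbA
    refine Integrable.of_bound ((hb.mul hwc).aestronglyMeasurable hΩm) (A * M) ?_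
    filter_upwards [ae_restrict_mem hΩm] with x hx
    rw [norm_mul]
    exact mul_le_mul (hbA x hx) (hwM x hx) (norm_nonneg _) ((abs_nonneg _).trans (hbA x hx))
  have hpot : ∀ s t : ℝ, Integrable (fun x => ∫ τ in (0 : ℝ)..(toFun (w₀ + (s • p + t • q)) x),
      f x τ) (volume.restrict Ω) := by
    intro s t
    obtain ⟨B, hB⟩ := hfb (M + (|s| * M + |t| * M))
    refine hf.integrable_potential hB (memLp_toFun _).1.aemeasurable ?_
    filter_upwards [toFun_add w₀ (s • p + t • q), toFun_add (s • p) (t • q), toFun_smul s p,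
      toFun_smul t q, hu, hp, hq, ae_restrict_mem hΩm] with x h1 h2 h3 h4 h5 h6 h7 hx
    rw [h1, Pi.add_apply, h2, Pi.add_apply, h3, h4, Pi.smul_apply, Pi.smul_apply, h5, h6, h7]
    have hind : ∀ D : Set (RN N), |D.indicator w x| ≤ M := fun D => by
      by_cases hxD : x ∈ D
      · rw [indicator_of_mem hxD]
        exact hwM x hx
      · rw [indicator_of_notMem hxD, abs_zero]
        exact (abs_nonneg _).trans (hwM x hx)
    refine (abs_add_le _ _).trans (add_le_add (huM x hx) ((abs_add_le _ _).trans
      (add_le_add ?_ ?_)))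
    · rw [smul_eq_mul, abs_mul]
      exact mul_le_mul_of_nonneg_left (hind D₁) (abs_nonneg s)
    · rw [smul_eq_mul, abs_mul]
      exact mul_le_mul_of_nonneg_left (hind D₂) (abs_nonneg t)
  obtain ⟨hint, heq⟩ := energy_add_sub hD₁ hD₂ hdisj hu hp hq hpq (hmul a hac haA) (hmul h hhc hhA)
    hlin₁ hlin₂ hquad₁ hquad₂ hpot s t
  have hle : ∀ᵐ x ∂(volume.restrict Ω), 0 < w x → ∀ m : ℝ, |m| ≤ 1 →
      incrementDensity f u w a h m x ≤ 0 := by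
    filter_upwards [hconv, hf.2, ae_restrict_mem hΩm] with x hx hc hxΩ hwx m hm
    have := hx.le_integral_increment hc hwx (hJ x hxΩ hwx) (neg_le_of_abs_le hm)
    rw [incrementDensity, haf x hxΩ, hhf x hxΩ]
    linarith
  have htotle : ∀ᵐ x ∂(volume.restrict Ω), D₁.indicator (incrementDensity f u w a h s) x +
      D₂.indicator (incrementDensity f u w a h t) x ≤ 0 := by
    filter_upwards [hle] with x hx
    refine add_nonpos ?_ ?_
    · by_cases hxD : x ∈ D₁
      · rw [indicator_of_mem hxD]
        exact hx (hw₁ x hxD) s hs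
      · rw [indicator_of_notMem hxD]
    · by_cases hxD : x ∈ D₂
      · rw [indicator_of_mem hxD]
        exact hx (hw₂ x hxD) t ht
      · rw [indicator_of_notMem hxD]
  have hI := integral_nonpos_of_ae htotle
  refine ⟨by linarith, fun hstrict hne => ?_⟩
  rw [← sub_neg, heq]
  -- A nonpositive density with zero integral vanishes almost everywhere. Yet it is negative on the
  -- set of positive measure belonging to a nonzero coefficient.
  refine lt_of_le_of_ne hI fun hI0 => ?_
  have hlt : ∀ᵐ x ∂(volume.restrict Ω), 0 < w x → ∀ m : ℝ, |m| ≤ 1 → m ≠ 0 →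
      incrementDensity f u w a h m x < 0 := by
    filter_upwards [hstrict, hf.2, ae_restrict_mem hΩm] with x hx hc hxΩ hwx m hm hm0
    have := hx.lt_integral_increment hc hwx (hJ x hxΩ hwx) (neg_le_of_abs_le hm) hm0
    rw [incrementDensity, haf x hxΩ, hhf x hxΩ]
    linarith
  have hzero : ∀ᵐ x ∂(volume.restrict Ω), D₁.indicator (incrementDensity f u w a h s) x +
      D₂.indicator (incrementDensity f u w a h t) x = 0 := by
    have h1 := (integral_eq_zero_iff_of_nonneg_ae (μ := volume.restrict Ω)
      (f := fun x => -(D₁.indicator (incrementDensity f u w a h s) x +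
        D₂.indicator (incrementDensity f u w a h t) x))
      (htotle.mono fun x hx => neg_nonneg.2 hx) hint.neg).1 (by rw [integral_neg, hI0, neg_zero])
    filter_upwards [h1] with x hx
    exact neg_eq_zero.1 hx
  by_cases hs0 : s = 0
  · have ht0 : t ≠ 0 := by
      rintro rfl
      exact hne (by rw [hs0, zero_smul, zero_smul, add_zero, add_zero])
    refine hμ₂.ne' (measure_mono_null (fun x hx => ?_) (mem_ae_iff.1 (hzero.and hlt)))
    rintro ⟨h1, h2⟩
    rw [indicator_of_notMem (disjoint_right.1 hdisj hx), indicator_of_mem hx, zero_add] at h1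
    exact (h2 (hw₂ x hx) t ht ht0).ne h1
  · refine hμ₁.ne' (measure_mono_null (fun x hx => ?_) (mem_ae_iff.1 (hzero.and hlt)))
    rintro ⟨h1, h2⟩
    rw [indicator_of_notMem (disjoint_left.1 hdisj hx), indicator_of_mem hx, add_zero] at h1
    exact (h2 (hw₁ x hx) s hs hs0).ne h1

end Assembly

end

/-! ### The theorem: reflection argument and choice of V. -/

set_option maxHeartbeats 2000000 in
theorem corollary1p6 (N : ℕ) (hN : 2 ≤ N) (Ω : Set (RN N)) (hΩ : IsBallOrAnnulus Ω)
    (f : RN N → ℝ → ℝ) (hf : IsCaratheodoryOn Ω f)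
    (hf_rad : ∀ t : ℝ, IsRadialOn Ω (fun x => f x t))
    (C r : ℝ) (hC : 0 < C) (hr : 1 < r) (hrN : 3 ≤ N → r < 2 * (N : ℝ) / ((N : ℝ) - 2))
    (hf_growth : ∀ᵐ x ∂(volume.restrict Ω), ∀ t : ℝ, |f x t| ≤ C * (|t| ^ (r - 1) + 1))
    (hf_lip : ∀ M : ℝ, 0 < M → ∃ CM : ℝ, 0 < CM ∧ ∀ᵐ x ∂(volume.restrict Ω),
      ∀ s ∈ Icc (-M) M, ∀ t ∈ Icc (-M) M, |f x s - f x t| ≤ CM * |s - t|)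
    (u₀ : RN N → ℝ) (hu₀ : IsClassicalSolution Ω f u₀)
    (J : Set ℝ) (hJ : J = univ ∨ (J = Ici 0 ∧ ∀ x ∈ Ω, 0 ≤ u₀ x))
    (hf_conv : ∀ᵐ x ∂(volume.restrict Ω), ConvexOn ℝ J (f x))
    (P : RN N) (hP : P ∈ Ω) (hP_crit : fderiv ℝ u₀ P = 0)
    (hsymm : (P ≠ 0 ∧ ¬ IsAxiallySymmetricOn Ω P u₀) ∨ (P = 0 ∧ ¬ IsRadialOn Ω u₀)) :
    ∃ w₀ : H10 Ω, H10.toFun w₀ =ᵐ[volume.restrict Ω] u₀ ∧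
      ∃ V : Submodule ℝ (H10 Ω), Module.finrank ℝ V = 2 ∧ (∃ v ∈ V, IsSignDefinite v) ∧
        (∀ᶠ w in 𝓝[{w | w - w₀ ∈ V}] w₀, energy Ω f w ≤ energy Ω f w₀) ∧
        ((∀ᵐ x ∂(volume.restrict Ω), StrictConvexOn ℝ J (f x)) →
          ∀ᶠ w in 𝓝[{w | w - w₀ ∈ V}] w₀, w ≠ w₀ → energy Ω f w < energy Ω f w₀) := by
  have hΩo := hΩ.isOpen
  have hΩb := hΩ.isBounded
  have hΩm := hΩo.measurableSet
  have hfin : IsFiniteMeasure (volume.restrict Ω) :=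
    ⟨by rw [Measure.restrict_apply_univ]; exact hΩb.measure_lt_top⟩
  have hu0 : ∀ x ∈ closure Ω \ Ω, u₀ x = 0 := fun x hx =>
    hu₀.boundary x (by rw [hΩo.frontier_eq]; exact hx)
  obtain ⟨x₁, hx₁, y₁, hy₁, hinner, hnorm, hneq⟩ : ∃ x ∈ Ω, ∃ y ∈ Ω,
      inner ℝ x P = inner ℝ y P ∧ ‖x‖ = ‖y‖ ∧ u₀ x ≠ u₀ y := by
    rcases hsymm with ⟨-, h⟩ | ⟨rfl, h⟩
    · simpa [IsAxiallySymmetricOn] using h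
    · simpa [IsRadialOn] using h
  obtain ⟨e, he⟩ : ∃ e, e = x₁ - y₁ := ⟨_, rfl⟩
  have he0 : e ≠ 0 := by
    rintro rfl
    exact hneq (by rw [sub_eq_zero.1 he.symm])
  set σ : RN N ≃ₗᵢ[ℝ] RN N := (ℝ ∙ e)ᗮ.reflection with hσ
  have hσfix : ∀ z : RN N, inner ℝ z e = 0 → σ z = z := fun z hz =>
    Submodule.reflection_mem_subspace_eq_self (Submodule.mem_orthogonal_singleton_iff_inner_left.2 hz)
  have hσσ : ∀ z, σ (σ z) = z := fun z => Submodule.reflection_reflection _ z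
  have hσe : σ e = -e := Submodule.reflection_orthogonalComplement_singleton_eq_neg e
  have hσin : ∀ z, inner ℝ (σ z) e = -inner ℝ z e := fun z => by
    rw [← σ.inner_map_map (σ z) e, hσσ, hσe, inner_neg_right]
  have hσx₁ : σ x₁ = y₁ := by
    rw [hσ, he]
    exact Submodule.reflection_sub hnorm
  have hPe : inner ℝ P e = 0 := by
    rw [real_inner_comm, he, inner_sub_left, hinner, sub_self]
  have hσΩ : MapsTo σ Ω Ω := fun z hz => hΩ.mem_of_norm_eq hz (σ.norm_map z)
  have hσcl : MapsTo σ (closure Ω) (closure Ω) := hσΩ.closure σ.continuous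
  have hσfr : ∀ z ∈ closure Ω \ Ω, σ z ∈ closure Ω \ Ω := fun z hz =>
    ⟨hσcl hz.1, fun h => hz.2 (by rw [← hσσ z]; exact hσΩ h)⟩
  obtain ⟨w, hw⟩ : ∃ w : RN N → ℝ, w = u₀ - u₀ ∘ σ := ⟨_, rfl⟩
  have hwx : ∀ z, w z = u₀ z - u₀ (σ z) := fun z => by rw [hw]; rfl
  have hσC2 : ContDiffOn ℝ 2 (u₀ ∘ σ) Ω :=
    hu₀.contDiffOn.comp σ.toContinuousLinearEquiv.contDiff.contDiffOn hσΩ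
  have hwC2 : ContDiffOn ℝ 2 w Ω := by
    rw [hw]
    exact hu₀.contDiffOn.sub hσC2
  have hwcl : ContinuousOn w (closure Ω) := by
    rw [hw]
    exact hu₀.continuousOn.sub (hu₀.continuousOn.comp σ.continuous.continuousOn hσcl)
  have hw0 : ∀ x ∈ closure Ω \ Ω, w x = 0 := fun x hx => by
    rw [hwx, hu0 x hx, hu0 _ (hσfr x hx), sub_self]
  have hwe : ∀ x, inner ℝ x e = 0 → w x = 0 := fun x hx => by
    rw [hwx, hσfix x hx, sub_self]
  have hlapw : ∀ x ∈ Ω, Laplacian.laplacian w x = -(f x (u₀ x) - f x (u₀ x - w x)) := by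
    intro x hx
    have h1 := hu₀.contDiffOn.contDiffAt (hΩo.mem_nhds hx)
    have h2 := hu₀.contDiffOn.contDiffAt (hΩo.mem_nhds (hσΩ hx))
    rw [hwx, sub_sub_cancel, hw, h1.laplacian_sub (hσC2.contDiffAt (hΩo.mem_nhds hx)),
      laplacian_comp_isometry σ h2]
    have h3 := hu₀.equation x hx
    have h4 := hu₀.equation (σ x) (hσΩ hx)
    -- Radiality of f enters here, through |σx| = |x|: the reflected function solves the same
    -- equation.
    have h5 : f (σ x) (u₀ (σ x)) = f x (u₀ (σ x)) := hf_rad _ _ (hσΩ hx) _ hx (σ.norm_map x)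
    linarith
  obtain ⟨M₀, hM₀⟩ := hΩb.isCompact_closure.exists_bound_of_continuousOn hu₀.continuousOn
  obtain ⟨M, hMpos, hM₀M⟩ : ∃ M : ℝ, 0 < M ∧ M₀ ≤ M := ⟨max M₀ 1, by positivity, le_max_left _ _⟩
  have hM : ∀ x ∈ Ω, |u₀ x| ≤ M := fun x hx => (hM₀ x (subset_closure hx)).trans hM₀M
  have hfb : ∀ M : ℝ, ∃ B : ℝ, ∀ᵐ x ∂(volume.restrict Ω), ∀ t : ℝ, |t| ≤ M → |f x t| ≤ B := by
    intro M
    refine ⟨C * (M ^ (r - 1) + 1), hf_growth.mono fun x hx t ht => (hx t).trans ?_⟩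
    have := Real.rpow_le_rpow (abs_nonneg t) ht (sub_pos.2 hr).le
    gcongr
  obtain ⟨B, hB⟩ := hfb M
  have hlapB : ∀ x ∈ Ω, |Laplacian.laplacian u₀ x| ≤ B := by
    refine forall_le_of_ae_le (μ := volume) hΩo (continuousOn_laplacian hΩo hu₀.contDiffOn).abs
      continuousOn_const ?_
    filter_upwards [hB, ae_restrict_mem hΩm] with x h1 h2
    rw [← abs_neg, hu₀.equation x h2]
    exact h1 _ (hM x h2)
  -- `M` bounds both u₀ and u₀ ∘ σ, so one Lipschitz constant linearizes the equation for `w`.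
  obtain ⟨K, hK, hlip⟩ := hf_lip M hMpos
  have hlapK : ∀ x ∈ Ω, |Laplacian.laplacian w x| ≤ K * |w x| := by
    refine forall_le_of_ae_le (μ := volume) hΩo (continuousOn_laplacian hΩo hwC2).abs
      (continuousOn_const.mul hwC2.continuousOn.abs) ?_
    filter_upwards [hlip, ae_restrict_mem hΩm] with x h1 h2
    rw [hlapw x h2, abs_neg, hwx, sub_sub_cancel]
    exact h1 _ (abs_le.1 (hM x h2)) _ (abs_le.1 (hM _ (hσΩ h2)))
  have hw2M : ∀ x ∈ Ω, |w x| ≤ 2 * M := fun x hx => by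
    rw [hwx]
    have := (abs_sub (u₀ x) (u₀ (σ x))).trans (add_le_add (hM x hx) (hM _ (hσΩ hx)))
    linarith
  have hlapw2 : ∀ x ∈ Ω, |Laplacian.laplacian w x| ≤ K * (2 * M) := fun x hx =>
    (hlapK x hx).trans (mul_le_mul_of_nonneg_left (hw2M x hx) hK.le)
  have hcrit : fderiv ℝ w P = 0 := by
    have h1 : DifferentiableAt ℝ u₀ P :=
      (hu₀.contDiffOn.contDiffAt (hΩo.mem_nhds hP)).differentiableAt (by norm_num)
    have h2 : DifferentiableAt ℝ (u₀ ∘ σ) P :=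
      (hσC2.contDiffAt (hΩo.mem_nhds hP)).differentiableAt (by norm_num)
    have h3 : fderiv ℝ (u₀ ∘ σ) P = 0 := by
      ext v
      rw [fderiv_comp_isometry, hσfix P hPe, hP_crit]
      rfl
    rw [hw, fderiv_sub h1 h2, hP_crit, h3, sub_zero]
  have hx₁e : 0 < inner ℝ x₁ e := by
    have h1 : inner ℝ x₁ e = ‖x₁ - y₁‖ ^ 2 / 2 := by
      rw [he, inner_sub_right, norm_sub_sq_real, real_inner_self_eq_norm_sq, ← hnorm]
      ring
    rw [h1, ← he]
    have := norm_pos_iff.2 he0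
    positivity
  have hwx₁ : w x₁ ≠ 0 := by
    rw [hwx, hσx₁]
    exact sub_ne_zero.2 hneq
  have hpos₁ : ∃ x ∈ Ω, 0 < inner ℝ x e ∧ 0 < w x :=
    exists_pos_of_critical_point hΩ he0 hwC2 hK.le hlapK hP hPe (hwe P hPe) hcrit
      ⟨x₁, hx₁, hx₁e, hwx₁⟩
  have hpos₂ : ∃ x ∈ Ω, 0 < inner ℝ x (-e) ∧ 0 < w x := by
    -- Since `w` is odd under σ, positivity on the other side amounts to positivity of `-w` on this
    -- side.
    obtain ⟨z, hz1, hz2, hz3⟩ := exists_pos_of_critical_point (w := -w) hΩ he0 hwC2.neg hK.le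
      (fun x hx => by rw [InnerProductSpace.laplacian_neg]; simpa using hlapK x hx) hP hPe
      (by simp [hwe P hPe]) (by rw [fderiv_neg, hcrit, neg_zero])
      ⟨x₁, hx₁, hx₁e, by simpa using hwx₁⟩
    refine ⟨σ z, hσΩ hz1, ?_, ?_⟩
    · rwa [inner_neg_right, hσin, neg_neg]
    · rw [Pi.neg_apply, hwx] at hz3
      rw [hwx, hσσ]
      linarith
  obtain ⟨D₁, hD₁⟩ : ∃ D, D = (Ω ∩ {x | 0 < inner ℝ x e}) ∩ {x | 0 < w x} := ⟨_, rfl⟩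
  obtain ⟨D₂, hD₂⟩ : ∃ D, D = (Ω ∩ {x | 0 < inner ℝ x (-e)}) ∩ {x | 0 < w x} := ⟨_, rfl⟩
  have hdisj : Disjoint D₁ D₂ := by
    rw [disjoint_left, hD₁, hD₂]
    rintro z ⟨⟨-, h1⟩, -⟩ ⟨⟨-, h2⟩, -⟩
    rw [mem_ofPred_eq] at h1 h2
    rw [inner_neg_right] at h2
    linarith
  have hw₁ : ∀ x ∈ D₁, 0 < w x := fun x hx => by rw [hD₁] at hx; exact hx.2
  have hw₂ : ∀ x ∈ D₂, 0 < w x := fun x hx => by rw [hD₂] at hx; exact hx.2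
  obtain ⟨hD₁o, hμ₁, p, hpsd, hp1, hp2, hp3⟩ := H10.exists_halfSpace_posPart hΩo hΩb hwC2 hwcl hw0
    hlapw2 (fun x _ => hwe x) hpos₁ hD₁
  obtain ⟨hD₂o, hμ₂, q, hqsd, hq1, hq2, hq3⟩ := H10.exists_halfSpace_posPart hΩo hΩb hwC2 hwcl hw0
    hlapw2 (fun x _ hx => hwe x (by rwa [inner_neg_right, neg_eq_zero] at hx)) hpos₂ hD₂
  obtain ⟨w₀, hw₀, hweak⟩ := H10.exists_classical hΩo hΩb hu₀.contDiffOn hu₀.continuousOn hu0 hlapB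
  have hpq := dirichlet_eq_zero_of_disjoint hdisj hp2 hq2
  have hinn := inner_eq_zero_of_disjoint hdisj hp1 hq1 hpq
  have hlin : ∀ (v : H10 Ω) (D : Set (RN N)), H10.toFun v =ᵐ[volume.restrict Ω] D.indicator w →
      H10.dirichlet w₀ v = ∫ x in Ω, D.indicator (fun x => -Laplacian.laplacian u₀ x * w x) x := by
    intro v D hv
    rw [H10.dirichlet_eq, hweak v, ← integral_neg]
    refine integral_congr_ae ?_
    filter_upwards [hv] with x hx
    rw [hx]
    by_cases hxD : x ∈ D
    · simp only [indicator_of_mem hxD]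
      ring
    · simp [indicator_of_notMem hxD]
  have hJmem : ∀ x ∈ Ω, 0 < w x → ∀ τ : ℝ, -1 ≤ τ → u₀ x + τ * w x ∈ J := by
    intro x hx hwpos τ hτ
    rcases hJ with rfl | ⟨rfl, hnn⟩
    · exact mem_univ _
    · rw [mem_Ici]
      -- For τ ≥ -1 and w(x) > 0, u₀ + τw ≥ u₀ - w = u₀ ∘ σ ≥ 0.
      have h1 := hnn _ (hσΩ hx)
      have h2 := hwx x
      nlinarith
  have hlapc := continuousOn_laplacian hΩo hu₀.contDiffOn
  -- The linear and quadratic densities are taken with a = -Δu₀ and h = -Δw, continuous and bounded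
  -- on Ω; the equations identify them with the values of f.
  have hmax := fun (s t : ℝ) (hs : |s| ≤ 1) (ht : |t| ≤ 1) =>
    energy_local_max hΩo hf hfb hD₁o.measurableSet hD₂o.measurableSet hdisj hμ₁ hμ₂ hw₁ hw₂ hw₀
      hp1 hq1 hpq hlapc.neg (continuousOn_laplacian hΩo hwC2).neg hwC2.continuousOn
      (M := 2 * M) (A := max B (K * (2 * M))) (fun x hx => (hM x hx).trans (by linarith)) hw2M
      (fun x hx => by rw [Pi.neg_apply, abs_neg]; exact (hlapB x hx).trans (le_max_left _ _))
      (fun x hx => by rw [Pi.neg_apply, abs_neg]; exact (hlapw2 x hx).trans (le_max_right _ _))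
      (hlin p D₁ hp1) (hlin q D₂ hq1) hp3 hq3 hu₀.equation
      (fun x hx => by rw [Pi.neg_apply, hlapw x hx, neg_neg]) hJmem hf_conv hs ht
  refine ⟨w₀, hw₀, Submodule.span ℝ {p, q}, finrank_span_pair_of_orthogonal hpsd.1 hqsd.1 hinn,
    ⟨p, Submodule.subset_span (by simp), hpsd⟩, ?_, fun hstrict => ?_⟩
  · exact eventually_of_forall_coeff_le_one hpsd.1 hqsd.1 hinn fun s t hs ht => (hmax s t hs ht).1
  · exact eventually_of_forall_coeff_le_one hpsd.1 hqsd.1 hinn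
      fun s t hs ht => (hmax s t hs ht).2 hstrict
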